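/- Let $A$ be a finite alphabet, let $M$ be a finite monoid and let $\alpha\colon A^*\to M$ be a monoid morphism. Conventions. For a word $w$, $\mathsf{alph}(w)\subseteq A$ denotes the set of letters occurring in $w$. Words are viewed as structures whose elements are the positions, with the order $<$ on positions and one unary label predicate for each letter. A first-order formula (not necessarily in prenex form) is $\Sigma_2$ if, after its quantifiers are pulled to the front, it consists of at most two blocks of quantifiers, where the first of two blocks is existential. For $k\in\mathbb N$ write $w\lesssim_k w'$ if every $\Sigma_2$ sentence of quantifier rank at most $k$ satisfied by $w$ is satisfied by $w'$. For $n\ge 1$, the set $M^n$ is a monoid for the componentwise product, and $2^{M^n}$ is a monoid for the product $S\cdot T=\{\bar s\,\bar t\mid \bar s\in S,\ \bar t\in T\}$; $\omega$ denotes a positive integer such that $T^\omega$ is idempotent for all $T\in 2^{M^n}$. For $n\geq 1$ and $B\subseteq A$: - a tuple $(s_1,\dots,s_n)\in M^n$ is in $\mathcal C_{2,n}[\alpha,B]$ (the $\Sigma_2$-chains of length $n$ for $(\alpha,B)$) if for every $k$ there are words $w_1\lesssim_k w_2\lesssim_k\cdots\lesssim_k w_n$ with $\alpha(w_j)=s_j$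 and $\mathsf{alph}(w_j)=B$ for all $j$; - a set $T\subseteq M^n$ is in $\mathfrak C^{k}_{2,n}[\alpha,B]$ (the compatible sets of $\Sigma_2[k]$-chains of length $n$ for $(\alpha,B)$) if there is a word $w$ with $\mathsf{alph}(w)=B$ such that for every $(s_1,\dots,s_n)\in T$ one has $\alpha(w)=s_1$ and there are words $w_2,\dots,w_n$ with $w\lesssim_k w_2\lesssim_k\cdots\lesssim_k w_n$ and with $\alpha(w_j)=s_j$ and $\mathsf{alph}(w_j)=B$ for $j=2,\dots,n$; and $\mathfrak C_{2,n}[\alpha,B]=\bigcap_{k\in\mathbb N}\mathfrak C^k_{2,n}[\alpha,B]$ (the compatible sets of $\Sigma_2$-chains); - $\mathfrak I_n[B]=\bigl\{\{(\alpha(w),\dots,\alpha(w))\}\mid \mathsf{alph}(w)=B\bigr\}$ (the trivial compatible sets). The procedure $Sat_n$ maps a function $f\colon 2^A\to 2^{2^{M^n}}$ to another such function. $Sat_1$ is the identity, and for $n\ge2$, $Sat_n(f)(B)$ is the union of $f(B)$, of $\{S\cdot T\mid S\in f(C),\ T\in f(D),\ C\cup D=B\}$ and of $\{T^\omega\cdot(1_M,\mathcal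 C_{2,n-1}[\alpha,B])\cdot T^\omega\mid T\in f(B)\}$, where $(1_M,C)=\{(1_M,s_1,\dots,s_{n-1})\mid(s_1,\dots,s_{n-1})\in C\}$. Since $f(B)\subseteq Sat_n(f)(B)$ and everything is finite, iterating $Sat_n$ from $f$ reaches a fixpoint, denoted by $Sat_n^*(f)$. For $\mathfrak T\subseteq 2^{M^n}$, $\downarrow\mathfrak T=\{T\mid \exists S\in\mathfrak T,\ T\subseteq S\}$. **Proposition 1.** Let $n\ge 1$, $B\subseteq A$ and $\ell\ge 3|M|\cdot 2^{|A|}\cdot n\cdot 2^{2^{2|M|^n}}$. Then $$\mathfrak C_{2,n}[\alpha,B]=\mathfrak C^{\ell}_{2,n}[\alpha,B]=\ \downarrow Sat_n^*\bigl(C\mapsto\mathfrak I_n[C]\bigr)(B).$$ -/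

import Mathlib

open scoped Pointwise

/-! ### First-order logic over words -/

/-- The relation symbols of `FO(<)` over the alphabet `A`: a unary predicate for every letter
and the binary predicate `<`. -/
inductive WordRel.{u} (A : Type u) : ℕ → Type u
  | letter (a : A) : WordRel A 1
  | lt : WordRel A 2

/-- The signature of `FO(<)` over the alphabet `A` (equality is built into the logic). -/
def wordLanguage.{u} (A : Type u) : FirstOrder.Language.{0, u} where
  Functions := fun _ => Empty
  Relations := WordRel A

/-- The set of positions of a word. -/
def Pos {A : Type*} (w : FreeMonoid A) : Type := Fin (FreeMonoid.toList w).length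

/-- The label of a position. -/
def Pos.label {A : Type*} {w : FreeMonoid A} (x : Pos w) : A := (FreeMonoid.toList w).get x

/-- A word, seen as a logical structure whose elements are its positions. -/
instance wordStructure {A : Type*} (w : FreeMonoid A) : (wordLanguage A).Structure (Pos w) where
  funMap := fun f _ => Empty.elim f
  RelMap := fun {_} R =>
    match R with
    | WordRel.letter a => fun x => (x 0).label = a
    | WordRel.lt => fun x => Fin.val (x 0) < Fin.val (x 1)

/-- The quantifier rank: the maximal number of nested quantifiers. (The primitive connectives of
`BoundedFormula` are `⊥`, `→` and `∀`; `¬ φ` is `φ → ⊥` and `∃` is `¬ ∀ ¬`.) -/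
def quantifierRank {L : FirstOrder.Language} {V : Type*} :
    {m : ℕ} → L.BoundedFormula V m → ℕ
  | _, .falsum => 0
  | _, .equal _ _ => 0
  | _, .rel _ _ => 0
  | _, .imp φ ψ => max (quantifierRank φ) (quantifierRank ψ)
  | _, .all φ => quantifierRank φ + 1

/-- `InLevel true i φ` says that `φ` is a `Σᵢ` formula, `InLevel false i φ` that it is a `Πᵢ`
formula: once the quantifiers are pulled to the front, there are at most `i` blocks of
quantifiers, the first one of `i` blocks being existential (resp. universal). The formula itself
need not be in prenex form. Atomic formulas are in every class; the premise of an implication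
changes polarity; `Πᵢ` is closed under `∀` for `i ≥ 1` (hence `Σᵢ` under `∃`); and
`Πᵢ ⊆ Σᵢ₊₁`, `Σᵢ ⊆ Πᵢ₊₁`. -/
inductive InLevel {L : FirstOrder.Language} {V : Type*} :
    Bool → ℕ → {m : ℕ} → L.BoundedFormula V m → Prop
  | falsum (b : Bool) (i : ℕ) {m : ℕ} :
      InLevel b i (FirstOrder.Language.BoundedFormula.falsum : L.BoundedFormula V m)
  | equal (b : Bool) (i : ℕ) {m : ℕ} (t₁ t₂ : L.Term (V ⊕ Fin m)) :
      InLevel b i (FirstOrder.Language.BoundedFormula.equal t₁ t₂)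
  | rel (b : Bool) (i : ℕ) {m r : ℕ} (R : L.Relations r) (ts : Fin r → L.Term (V ⊕ Fin m)) :
      InLevel b i (FirstOrder.Language.BoundedFormula.rel R ts)
  | imp {b : Bool} {i m : ℕ} {φ ψ : L.BoundedFormula V m} :
      InLevel (!b) i φ → InLevel b i ψ → InLevel b i (φ.imp ψ)
  | all {i m : ℕ} {φ : L.BoundedFormula V (m + 1)} :
      InLevel false (i + 1) φ → InLevel false (i + 1) φ.all
  | lift {b : Bool} {i m : ℕ} {φ : L.BoundedFormula V m} :
      InLevel (!b) i φ → InLevel b (i + 1) φ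

/-- The preorder of `Σᵢ` at rank `k`: every `Σᵢ` sentence of quantifier rank (at most) `k`
satisfied by `w` is satisfied by `w'`. -/
def SigmaLE {A : Type*} (i k : ℕ) (w w' : FreeMonoid A) : Prop :=
  ∀ φ : (wordLanguage A).Sentence, InLevel true i φ → quantifierRank φ ≤ k →
    FirstOrder.Language.Sentence.Realize (Pos w) φ →
    FirstOrder.Language.Sentence.Realize (Pos w') φ

/-! ### Chains and compatible sets of chains -/

/-- The alphabet of a word: the set of letters that occur in it. -/
def content {A : Type*} (w : FreeMonoid A) : Set A := {a | a ∈ FreeMonoid.toList w}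

/-- `w₁ ≤ w₂ ≤ ⋯ ≤ wₙ` for the preorder of `Σ₂` at rank `k`. -/
def IsSigmaTwoChain {A : Type*} (k : ℕ) {n : ℕ} (w : Fin n → FreeMonoid A) : Prop :=
  ∀ i j : Fin n, j.val = i.val + 1 → SigmaLE 2 k (w i) (w j)

/-- The `Σ₂[k]`-chains of length `n` for `(α, B)`. -/
def chainsRank {A M : Type*} [Monoid M] (α : FreeMonoid A →* M) (n k : ℕ) (B : Set A) :
    Set (Fin n → M) :=
  {s | ∃ w : Fin n → FreeMonoid A, IsSigmaTwoChain k w ∧ (∀ j, α (w j) = s j) ∧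
    ∀ j, content (w j) = B}

/-- The `Σ₂`-chains of length `n` for `(α, B)`. -/
def chains {A M : Type*} [Monoid M] (α : FreeMonoid A →* M) (n : ℕ) (B : Set A) :
    Set (Fin n → M) :=
  {s | ∀ k : ℕ, s ∈ chainsRank α n k B}

/-- The compatible sets of `Σ₂[k]`-chains of length `n` for `(α, B)`: the same first word `w`
works for all the chains of the set. -/
def compatRank {A M : Type*} [Monoid M] (α : FreeMonoid A →* M) (n k : ℕ) (B : Set A) :
    Set (Set (Fin n → M)) :=
  {T | ∃ w : FreeMonoid A, content w = B ∧ ∀ s ∈ T, ∃ u : Fin n → FreeMonoid A,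
    (∀ j, j.val = 0 → u j = w) ∧ IsSigmaTwoChain k u ∧ (∀ j, α (u j) = s j) ∧
    ∀ j, content (u j) = B}

/-- The compatible sets of `Σ₂`-chains of length `n` for `(α, B)`. -/
def compat {A M : Type*} [Monoid M] (α : FreeMonoid A →* M) (n : ℕ) (B : Set A) :
    Set (Set (Fin n → M)) :=
  {T | ∀ k : ℕ, T ∈ compatRank α n k B}

/-- The downset of a set of sets of chains. -/
def downset {X : Type*} (𝒯 : Set (Set X)) : Set (Set X) := {T | ∃ S ∈ 𝒯, T ⊆ S}

/-! ### The idempotent power -/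

/-- `ω(S)`: the least positive `m` such that `s ^ m` is idempotent for all `s` in `S`. -/
noncomputable def omegaExp (S : Type*) [Monoid S] : ℕ :=
  sInf {m | 0 < m ∧ ∀ s : S, IsIdempotentElem (s ^ m)}

theorem exists_pos_isIdempotentElem_pow {S : Type*} [Monoid S] [Finite S] (x : S) :
    ∃ m, 0 < m ∧ IsIdempotentElem (x ^ m) := by
  obtain ⟨i, j, hij, h⟩ : ∃ i j : ℕ, i < j ∧ x ^ i = x ^ j := by
    obtain ⟨i, j, hne, h⟩ := Finite.exists_ne_map_eq_of_infinite (fun k : ℕ => x ^ k)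
    rcases lt_or_gt_of_ne hne with hlt | hlt
    · exact ⟨i, j, hlt, h⟩
    · exact ⟨j, i, hlt, h.symm⟩
  obtain ⟨p, rfl⟩ := Nat.exists_eq_add_of_lt hij
  have step : ∀ m, i ≤ m → x ^ (m + (p + 1)) = x ^ m := by
    intro m hm
    obtain ⟨r, rfl⟩ := Nat.exists_eq_add_of_le hm
    calc x ^ (i + r + (p + 1)) = x ^ (i + p + 1) * x ^ r := by rw [← pow_add]; congr 1; ring
      _ = x ^ (i + r) := by rw [← h, ← pow_add]
  have steps : ∀ q m, i ≤ m → x ^ (m + q * (p + 1)) = x ^ m := by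
    intro q
    induction q with
    | zero => intro m _; simp
    | succ q ih =>
      intro m hm
      rw [← ih m hm, ← step (m + q * (p + 1)) (by omega)]
      congr 1; ring
  refine ⟨(i + 1) * (p + 1), by positivity, ?_⟩
  rw [IsIdempotentElem, ← pow_add]
  exact steps _ _ (by nlinarith)

theorem omegaExp_spec (S : Type*) [Monoid S] [Finite S] :
    0 < omegaExp S ∧ ∀ s : S, IsIdempotentElem (s ^ omegaExp S) := by
  have hne : {m | 0 < m ∧ ∀ s : S, IsIdempotentElem (s ^ m)}.Nonempty := by
    obtain ⟨m, hm, h⟩ := exists_pos_isIdempotentElem_pow (fun s : S => s)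
    exact ⟨m, hm, fun s => congrFun h s⟩
  exact Nat.sInf_mem hne

/-! ### The saturation procedure -/

/-- The trivial compatible sets of chains of length `n` for `(α, B)`. -/
def trivialSets {A M : Type*} [Monoid M] (α : FreeMonoid A →* M) (n : ℕ) (B : Set A) :
    Set (Set (Fin n → M)) :=
  {T | ∃ w : FreeMonoid A, content w = B ∧ T = {fun _ => α w}}

/-- One step of the saturation procedure for chains of length `n ≥ 1` (the value at `n = 0` is
irrelevant). For `n = 1` there is nothing to do. For `n ≥ 2`, the products and the sets
`T ^ ω * (1, C) * T ^ ω`, with `C` the set of `Σ₂`-chains of length `n - 1` for `(α, B)`, are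
added; all products and powers are those of the monoid of sets of chains. -/
noncomputable def sat {A M : Type*} [Monoid M] (α : FreeMonoid A →* M) :
    (n : ℕ) → (Set A → Set (Set (Fin n → M))) → Set A → Set (Set (Fin n → M))
  | 0, f => f
  | 1, f => f
  | m + 2, f => fun B =>
      f B ∪ {R | ∃ C D : Set A, C ∪ D = B ∧ R ∈ f C * f D} ∪
        {R | ∃ T ∈ f B, R = T ^ omegaExp (Set (Fin (m + 2) → M)) *
          (fun s : Fin (m + 1) → M => (Fin.cons 1 s : Fin (m + 2) → M)) '' chains α (m + 1) B *
          T ^ omegaExp (Set (Fin (m + 2) → M))}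

/-- The number of iterations after which the procedure, started from `f`, first reaches a
fixpoint. -/
noncomputable def satSteps {A M : Type*} [Monoid M] (α : FreeMonoid A →* M) (n : ℕ)
    (f : Set A → Set (Set (Fin n → M))) : ℕ :=
  sInf {j | (sat α n)^[j + 1] f = (sat α n)^[j] f}

/-- The result of the procedure: iterate `sat` from `f` until a fixpoint is reached. -/
noncomputable def satStar {A M : Type*} [Monoid M] (α : FreeMonoid A →* M) (n : ℕ)
    (f : Set A → Set (Set (Fin n → M))) : Set A → Set (Set (Fin n → M)) :=
  (sat α n)^[satSteps α n f] f

theorem le_sat {A M : Type*} [Monoid M] (α : FreeMonoid A →* M) (n : ℕ)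
    (f : Set A → Set (Set (Fin n → M))) : f ≤ sat α n f := by
  match n, f with
  | 0, f => exact le_rfl
  | 1, f => exact le_rfl
  | m + 2, f => exact fun B T hT => Or.inl (Or.inl hT)

/-- The iteration does reach a fixpoint. -/
theorem sat_satStar {A M : Type*} [Finite A] [Monoid M] [Finite M] (α : FreeMonoid A →* M) (n : ℕ)
    (f : Set A → Set (Set (Fin n → M))) : sat α n (satStar α n f) = satStar α n f := by
  have hmono : Monotone fun j => (sat α n)^[j] f :=
    monotone_nat_of_le_succ fun j => by
      rw [Function.iterate_succ_apply']
      exact le_sat α n _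
  have hne : {j | (sat α n)^[j + 1] f = (sat α n)^[j] f}.Nonempty := by
    obtain ⟨j, hj⟩ := WellFoundedGT.monotone_chain_condition ⟨_, hmono⟩
    exact ⟨j, (hj (j + 1) (Nat.le_succ j)).symm⟩
  have h := Nat.sInf_mem hne
  rw [Set.mem_ofPred_eq, Function.iterate_succ_apply'] at h
  exact h

/-- All the sets computed along the iteration are in the result, and conversely. -/
theorem mem_satStar_iff {A M : Type*} [Finite A] [Monoid M] [Finite M] (α : FreeMonoid A →* M)
    (n : ℕ) (f : Set A → Set (Set (Fin n → M))) (B : Set A) (T : Set (Fin n → M)) :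
    T ∈ satStar α n f B ↔ ∃ j, T ∈ (sat α n)^[j] f B := by
  have hmono : Monotone fun j => (sat α n)^[j] f :=
    monotone_nat_of_le_succ fun j => by
      rw [Function.iterate_succ_apply']
      exact le_sat α n _
  refine ⟨fun h => ⟨_, h⟩, ?_⟩
  rintro ⟨j, hj⟩
  have h := hmono (Nat.le_add_right j (satSteps α n f)) B hj
  have hfix : (sat α n)^[j] (satStar α n f) = satStar α n f :=
    Function.iterate_fixed (sat_satStar α n f) j
  change T ∈ (sat α n)^[j + satSteps α n f] f B at h
  rw [Function.iterate_add_apply] at h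
  change T ∈ (sat α n)^[j] (satStar α n f) B at h
  rwa [hfix] at h

/-!
The equalities follow from three inclusions: a compatible set of `Σ₂`-chains is one of
`Σ₂[ℓ]`-chains by definition, so it remains to bound the compatible sets of `Σ₂[ℓ]`-chains by the
sets that the procedure produces (completeness), and to show that these are compatible at every
rank (soundness).

Everything about the logic goes through an Ehrenfeucht–Fraïssé game whose positions are words with
pairs of pebbles (`Wins`). Strategies on factors are glued together (`Wins.append`), and relativized
formulas show that the logical preorder provides strategies (`SigmaLE.split`, `sigmaLE_iff_wins`).
Hence the preorders are compatible with products, a comparison at rank `k + 1` of `x * y` with a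
word splits into two comparisons at rank `k`, and any word over the content of `w` can be inserted
into the middle of a high power of `w` (`sigmaLE_two_pow`). Soundness is immediate from these
facts.

For completeness, let `E k w` be the set of the images of the `Σ₂[k]`-chains that start with `w`
(`chainSet`). Splitting gives `E (k + 1) (x * y) ⊆ E k x * E k y`. By induction on the size of the
content `B` of `w`, cut `w` into blocks that are minimal with content `B`; each block `y` satisfies
`E k y ⊆ T y` for some set `T y` in the saturation. The number of blocks is not bounded, but the
rank may only drop by a bounded amount. By the pigeonhole principle, a bounded number of blocks
contains a cut and a product `Z` of sets `T y` such that `P Z = P` and `Z R = R` for the products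
`P` and `R` on both sides of the cut, so that `P R = P Z ^ ω Z ^ ω R` (`exists_absorbed_factor`).
Mark this cut by `Z` together with the value in `M` of the prefix before it. If `u` is the factor
between two cuts with the same mark, then the images of the chains that start with `u` have tails
in the set `C` of shorter chains, while their first entry `α u` is invisible after the prefix; so
the whole factor is handled by the one set `Z ^ ω (1, C) Z ^ ω` (`covers_omega`). Jumping from the
first cut with a mark to the last one uses up the mark, and there are boundedly many marks
(`exists_covers_list_prod`). The cost of a content level is thus polynomial in the sizes of `M` and
of the set of subsets of `M ^ n`, well below what the bound on `ℓ` allows (`rank_bound`). An induction on `n`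
ensures that chains of length `n - 1` at the available rank are chains at every rank.
-/

/-! ### Positions of words -/

section Pos

variable {A : Type*} {w : FreeMonoid A}

/-- A position as a natural number. -/
def Pos.idx (x : Pos w) : ℕ := Fin.val x

theorem Pos.idx_lt (x : Pos w) : x.idx < w.toList.length := Fin.isLt x

theorem Pos.idx_inj {x y : Pos w} : x.idx = y.idx ↔ x = y :=
  Fin.val_inj (a := (x : Fin w.toList.length))

theorem Pos.exists_idx_eq {p : ℕ} (hp : p < w.toList.length) : ∃ x : Pos w, x.idx = p :=
  ⟨(⟨p, hp⟩ : Fin _), rfl⟩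

theorem Pos.getElem?_idx (x : Pos w) : w.toList[x.idx]? = some x.label :=
  List.getElem?_eq_getElem x.idx_lt

end Pos

/-! ### The Ehrenfeucht–Fraïssé game -/

/-- The pairs of positions `Γ` form a partial isomorphism between two words. -/
def PartialIso {A : Type*} (u v : List A) (Γ : Set (ℕ × ℕ)) : Prop :=
  (∀ x ∈ Γ, x.1 < u.length ∧ x.2 < v.length ∧ u[x.1]? = v[x.2]?) ∧
    ∀ x ∈ Γ, ∀ y ∈ Γ, (x.1 < y.1 ↔ x.2 < y.2)

/-- Duplicator wins the `k`-round game of `Σᵢ` from `u` to `v`, the pairs of positions in `Γ`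
being already pebbled: Spoiler starts in `u` and may switch to the other word `i - 1` times. For
`i = 0` no move is left, whatever `k` is.
No order of the pebbles is recorded, so that strategies on two factors are glued by a union. -/
def Wins {A : Type*} : ℕ → ℕ → List A → List A → Set (ℕ × ℕ) → Prop
  | 0, _, u, v, Γ => PartialIso u v Γ
  | _ + 1, 0, u, v, Γ => PartialIso u v Γ
  | i + 1, k + 1, u, v, Γ => PartialIso u v Γ ∧ Wins i (k + 1) v u (Prod.swap ⁻¹' Γ) ∧
      ∀ p < u.length, ∃ q < v.length, Wins (i + 1) k u v (insert (p, q) Γ)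
termination_by i k => (i, k)

section Game

variable {A : Type*}

theorem PartialIso.mono {u v : List A} {Γ Δ : Set (ℕ × ℕ)} (h : PartialIso u v Γ) (hs : Δ ⊆ Γ) :
    PartialIso u v Δ :=
  ⟨fun _ hx => h.1 _ (hs hx), fun _ hx _ hy => h.2 _ (hs hx) _ (hs hy)⟩

theorem PartialIso.swap {u v : List A} {Γ : Set (ℕ × ℕ)} (h : PartialIso u v Γ) :
    PartialIso v u (Prod.swap ⁻¹' Γ) :=
  ⟨fun _ hx => ⟨(h.1 _ hx).2.1, (h.1 _ hx).1, (h.1 _ hx).2.2.symm⟩,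
    fun _ hx _ hy => (h.2 _ hx _ hy).symm⟩

theorem Wins.partialIso {i k : ℕ} {u v : List A} {Γ : Set (ℕ × ℕ)} (h : Wins i k u v Γ) :
    PartialIso u v Γ := by
  match i, k with
  | 0, _ => simpa [Wins] using h
  | _ + 1, 0 => simpa [Wins] using h
  | _ + 1, _ + 1 => rw [Wins] at h; exact h.1

theorem Wins.swap {i k : ℕ} {u v : List A} {Γ : Set (ℕ × ℕ)} (h : Wins (i + 1) k u v Γ) :
    Wins i k v u (Prod.swap ⁻¹' Γ) := by
  cases k with
  | zero => rw [Wins] at h; cases i <;> (rw [Wins]; exact h.swap)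
  | succ k => rw [Wins] at h; exact h.2.1

theorem Wins.mono {i : ℕ} : ∀ {k k' : ℕ} {u v : List A} {Γ Δ : Set (ℕ × ℕ)}, Wins i k u v Γ →
    k' ≤ k → Δ ⊆ Γ → Wins i k' u v Δ := by
  induction i with
  | zero => intro k k' u v Γ Δ h _ hs; rw [Wins] at h ⊢; exact h.mono hs
  | succ i ihi =>
    intro k
    induction k with
    | zero =>
      intro k' u v Γ Δ h hk hs
      obtain rfl : k' = 0 := by omega
      rw [Wins] at h ⊢
      exact h.mono hs
    | succ k ih =>
      intro k' u v Γ Δ h hk hs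
      cases k' with
      | zero => rw [Wins]; exact h.partialIso.mono hs
      | succ k' =>
        rw [Wins] at h ⊢
        refine ⟨h.1.mono hs, ihi h.2.1 hk (Set.preimage_mono hs), fun p hp => ?_⟩
        obtain ⟨q, hq, hw⟩ := h.2.2 p hp
        exact ⟨q, hq, ih hw (by omega) (Set.insert_subset_insert hs)⟩

theorem wordLanguage_term {V : Type*} (t : (wordLanguage A).Term V) : ∃ x, t = .var x := by
  cases t with
  | var x => exact ⟨x, rfl⟩
  | func f _ => exact Empty.elim f

/-- The soundness of the game: Duplicator's strategies transfer `Σᵢ` formulas from `u` to `v` and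
`Πᵢ` formulas from `v` to `u`. -/
theorem realize_of_wins {b : Bool} {i m : ℕ} {φ : (wordLanguage A).BoundedFormula Empty m}
    (hφ : InLevel b i φ) : ∀ {k : ℕ}, quantifierRank φ ≤ k → ∀ {u v : FreeMonoid A}
    {Γ : Set (ℕ × ℕ)} (xs : Fin m → Pos u) (ys : Fin m → Pos v),
    (∀ j, ((xs j).idx, (ys j).idx) ∈ Γ) → Wins i k u.toList v.toList Γ →
      (b = true → φ.Realize default xs → φ.Realize default ys) ∧
      (b = false → φ.Realize default ys → φ.Realize default xs) := by
  induction hφ with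
  | falsum => intros; exact ⟨fun _ h => h, fun _ h => h⟩
  | equal b i t₁ t₂ =>
    intro k _ u v Γ xs ys hΓ hw
    obtain ⟨x | x, rfl⟩ := wordLanguage_term t₁
    · exact x.elim
    obtain ⟨y | y, rfl⟩ := wordLanguage_term t₂
    · exact y.elim
    have h1 := hw.partialIso.2 _ (hΓ x) _ (hΓ y)
    have h2 := hw.partialIso.2 _ (hΓ y) _ (hΓ x)
    have key : xs x = xs y ↔ ys x = ys y := by
      rw [← Pos.idx_inj, ← Pos.idx_inj]
      dsimp only at h1 h2
      omega
    exact ⟨fun _ => key.1, fun _ => key.2⟩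
  | rel b i R ts =>
    intro k _ u v Γ xs ys hΓ hw
    suffices key : (FirstOrder.Language.BoundedFormula.rel R ts).Realize default xs ↔
        (FirstOrder.Language.BoundedFormula.rel R ts).Realize default ys from
      ⟨fun _ => key.1, fun _ => key.2⟩
    cases R with
    | letter a =>
      obtain ⟨x | x, hx⟩ := wordLanguage_term (ts 0)
      · exact x.elim
      have h := (hw.partialIso.1 _ (hΓ x)).2.2
      rw [Pos.getElem?_idx, Pos.getElem?_idx, Option.some_inj] at h
      change ((ts 0).realize _ : Pos u).label = a ↔ ((ts 0).realize _ : Pos v).label = a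
      rw [hx]
      change (xs x).label = a ↔ (ys x).label = a
      rw [h]
    | lt =>
      obtain ⟨x | x, hx⟩ := wordLanguage_term (ts 0)
      · exact x.elim
      obtain ⟨y | y, hy⟩ := wordLanguage_term (ts 1)
      · exact y.elim
      change ((ts 0).realize _ : Pos u).idx < ((ts 1).realize _ : Pos u).idx ↔
        ((ts 0).realize _ : Pos v).idx < ((ts 1).realize _ : Pos v).idx
      rw [hx, hy]
      exact hw.partialIso.2 _ (hΓ x) _ (hΓ y)
  | @imp b i m φ ψ _ _ ih₁ ih₂ =>
    intro k hk u v Γ xs ys hΓ hw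
    simp only [quantifierRank, max_le_iff] at hk
    have h1 := ih₁ hk.1 xs ys hΓ hw
    have h2 := ih₂ hk.2 xs ys hΓ hw
    simp only [FirstOrder.Language.BoundedFormula.realize_imp]
    refine ⟨fun hb h h' => ?_, fun hb h h' => ?_⟩ <;> subst hb
    · exact h2.1 rfl (h (h1.2 rfl h'))
    · exact h2.2 rfl (h (h1.1 rfl h'))
  | @all i m φ _ ih =>
    intro k hk u v Γ xs ys hΓ hw
    obtain ⟨k, rfl⟩ : ∃ k', k = k' + 1 := ⟨k - 1, by simp only [quantifierRank] at hk; omega⟩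
    refine ⟨fun hb => by simp at hb, fun _ h => ?_⟩
    rw [FirstOrder.Language.BoundedFormula.realize_all] at h ⊢
    intro p
    rw [Wins] at hw
    obtain ⟨_, hq, hw'⟩ := hw.2.2 p.idx p.idx_lt
    obtain ⟨q, rfl⟩ := Pos.exists_idx_eq hq
    refine (ih (by simpa [quantifierRank] using hk) (Fin.snoc (α := fun _ => Pos u) xs p)
      (Fin.snoc (α := fun _ => Pos v) ys q) ?_ hw').2 rfl (h _)
    intro j
    refine Fin.lastCases ?_ (fun j => ?_) j
    · rw [Fin.snoc_last, Fin.snoc_last]; exact Set.mem_insert _ _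
    · rw [Fin.snoc_castSucc, Fin.snoc_castSucc]; exact Set.mem_insert_of_mem _ (hΓ j)
  | @lift b i m φ _ ih =>
    intro k hk u v Γ xs ys hΓ hw
    have h := ih hk ys xs (Γ := Prod.swap ⁻¹' Γ) (fun j => hΓ j) hw.swap
    exact ⟨fun hb => h.2 (by simp [hb]), fun hb => h.1 (by simp [hb])⟩

theorem sigmaLE_of_wins {i k : ℕ} {u v : FreeMonoid A} (h : Wins i k u.toList v.toList ∅) :
    SigmaLE i k u v := fun _ hφ hk hr =>
  (realize_of_wins hφ hk default default (fun j => j.elim0) h).1 rfl hr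

/-- Strategies on two factors combine to a strategy on the product. -/
theorem Wins.append : ∀ {i k : ℕ} {u₁ u₂ v₁ v₂ : List A} {Γ₁ Γ₂ Γ : Set (ℕ × ℕ)},
    Wins i k u₁ v₁ Γ₁ → Wins i k u₂ v₂ Γ₂ →
    (∀ x ∈ Γ, x ∈ Γ₁ ∨ ∃ y ∈ Γ₂, x = (u₁.length + y.1, v₁.length + y.2)) →
    Wins i k (u₁ ++ u₂) (v₁ ++ v₂) Γ := by
  have base : ∀ {u₁ u₂ v₁ v₂ : List A} {Γ₁ Γ₂ Γ : Set (ℕ × ℕ)},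
      PartialIso u₁ v₁ Γ₁ → PartialIso u₂ v₂ Γ₂ →
      (∀ x ∈ Γ, x ∈ Γ₁ ∨ ∃ y ∈ Γ₂, x = (u₁.length + y.1, v₁.length + y.2)) →
      PartialIso (u₁ ++ u₂) (v₁ ++ v₂) Γ := by
    intro u₁ u₂ v₁ v₂ Γ₁ Γ₂ Γ h₁ h₂ hΓ
    constructor
    · intro x hx
      rcases hΓ x hx with h | ⟨y, h, rfl⟩
      · have := h₁.1 x h
        refine ⟨by simp; omega, by simp; omega, ?_⟩
        rw [List.getElem?_append_left this.1, List.getElem?_append_left this.2.1, this.2.2]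
      · have := h₂.1 y h
        refine ⟨by simp; omega, by simp; omega, ?_⟩
        rw [List.getElem?_append_right (by simp), List.getElem?_append_right (by simp)]
        simpa using this.2.2
    · intro x hx y hy
      rcases hΓ x hx with h | ⟨x', h, rfl⟩ <;> rcases hΓ y hy with h' | ⟨y', h', rfl⟩
      · exact h₁.2 x h y h'
      · have := h₁.1 x h
        dsimp only; omega
      · have := h₁.1 y h'
        dsimp only; omega
      · have := h₂.2 x' h y' h'
        dsimp only; omega
  intro i
  induction i with
  | zero =>
    intro k u₁ u₂ v₁ v₂ Γ₁ Γ₂ Γ h₁ h₂ hΓ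
    rw [Wins] at *
    exact base h₁ h₂ hΓ
  | succ i ihi =>
    intro k
    induction k with
    | zero =>
      intro u₁ u₂ v₁ v₂ Γ₁ Γ₂ Γ h₁ h₂ hΓ
      rw [Wins] at *
      exact base h₁ h₂ hΓ
    | succ k ih =>
      intro u₁ u₂ v₁ v₂ Γ₁ Γ₂ Γ h₁ h₂ hΓ
      have b := base h₁.partialIso h₂.partialIso hΓ
      have s := ihi h₁.swap h₂.swap (Γ := Prod.swap ⁻¹' Γ) (fun x hx => by
        rcases hΓ _ hx with h | ⟨y, h, e⟩
        · exact Or.inl h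
        · refine Or.inr ⟨y.swap, by simpa using h, ?_⟩
          rw [← Prod.swap_inj, e]; rfl)
      have h₁' := h₁
      have h₂' := h₂
      rw [Wins] at h₁ h₂ ⊢
      refine ⟨b, s, fun p hp => ?_⟩
      by_cases hp1 : p < u₁.length
      · obtain ⟨q, hq, hw⟩ := h₁.2.2 p hp1
        refine ⟨q, by simp; omega, ih hw (h₂'.mono (Nat.le_succ k) subset_rfl) ?_⟩
        · rintro x (rfl | hx)
          · exact Or.inl (Set.mem_insert _ _)
          · exact (hΓ x hx).imp (Set.mem_insert_of_mem _) id
      · obtain ⟨q, hq, hw⟩ := h₂.2.2 (p - u₁.length) (by simp at hp; omega)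
        refine ⟨v₁.length + q, by simp; omega, ih (h₁'.mono (Nat.le_succ k) subset_rfl) hw ?_⟩
        · rintro x (rfl | hx)
          · exact Or.inr ⟨_, Set.mem_insert _ _, by ext <;> simp; omega⟩
          · rcases hΓ x hx with h | ⟨y, h, e⟩
            · exact Or.inl h
            · exact Or.inr ⟨y, Set.mem_insert_of_mem _ h, e⟩

end Game

/-! ### Relativized formulas -/

section Relativize

variable {A : Type*}

open FirstOrder.Language

/-- The atomic formula `y < x₀` (for `b = true`) or `x₀ < y` (for `b = false`), where `x₀` is the
first variable and `y` the last one. -/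
def sideGuard (A : Type*) (b : Bool) (m : ℕ) : (wordLanguage A).BoundedFormula Empty (m + 2) :=
  .rel (WordRel.lt : (wordLanguage A).Relations 2)
    (if b then ![.var (.inr (Fin.last (m + 1))), .var (.inr 0)]
      else ![.var (.inr 0), .var (.inr (Fin.last (m + 1)))])

/-- The formula `φ`, relativized to the positions strictly on one side of a new first variable:
on its left for `b = true`, on its right for `b = false`. -/
def relativize (b : Bool) : {m : ℕ} → (wordLanguage A).BoundedFormula Empty m →
    (wordLanguage A).BoundedFormula Empty (m + 1)
  | _, .falsum => .falsum
  | _, .equal t₁ t₂ => .equal (t₁.relabel (Sum.map id Fin.succ)) (t₂.relabel (Sum.map id Fin.succ))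
  | _, .rel R ts => .rel R fun j => (ts j).relabel (Sum.map id Fin.succ)
  | _, .imp φ ψ => .imp (relativize b φ) (relativize b ψ)
  | m, .all φ => .all (.imp (sideGuard A b m) (relativize b φ))

theorem quantifierRank_relativize (b : Bool) {m : ℕ}
    (φ : (wordLanguage A).BoundedFormula Empty m) :
    quantifierRank (relativize b φ) = quantifierRank φ := by
  induction φ with
  | falsum => rfl
  | equal => rfl
  | rel => rfl
  | imp φ ψ h₁ h₂ => simp [relativize, quantifierRank, h₁, h₂]
  | all φ h => simp [relativize, quantifierRank, h, sideGuard]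

theorem InLevel.relativize (b : Bool) {c : Bool} {i m : ℕ}
    {φ : (wordLanguage A).BoundedFormula Empty m} (h : InLevel c i φ) :
    InLevel c i (relativize b φ) := by
  induction h with
  | falsum => exact .falsum _ _
  | equal => exact .equal _ _ _ _
  | rel => exact .rel _ _ _ _
  | imp _ _ h₁ h₂ => exact .imp h₁ h₂
  | all _ h => exact .all (.imp (.rel _ _ _ _) h)
  | lift _ h => exact .lift h

theorem realize_sideGuard {w : FreeMonoid A} (b : Bool) {m : ℕ} (xs : Fin (m + 2) → Pos w) :
    (sideGuard A b m).Realize default xs ↔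
      if b then (xs (Fin.last _)).idx < (xs 0).idx else (xs 0).idx < (xs (Fin.last _)).idx := by
  cases b <;> exact Iff.rfl

/-- If `e` embeds the word `u` as the factor of `w` on one side of `x`, then the relativization of
`φ` says in `w` what `φ` says in `u`. -/
theorem realize_relativize (b : Bool) {u w : FreeMonoid A} {c : ℕ} {e : Pos u → Pos w}
    (hidx : ∀ p, (e p).idx = p.idx + c) (hlabel : ∀ p, (e p).label = p.label) {x : Pos w}
    (hx : ∀ y : Pos w, (if b then y.idx < x.idx else x.idx < y.idx) ↔ ∃ p, e p = y) {m : ℕ}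
    (φ : (wordLanguage A).BoundedFormula Empty m) (xs : Fin m → Pos u) :
    (relativize b φ).Realize default (Fin.cons (α := fun _ => Pos w) x (e ∘ xs)) ↔
      φ.Realize default xs := by
  have hinj : ∀ p q, e p = e q ↔ p = q := by
    intro p q
    rw [← Pos.idx_inj, ← Pos.idx_inj, hidx, hidx]
    omega
  have hterm : ∀ {m : ℕ} (t : (wordLanguage A).Term (Empty ⊕ Fin m)) (xs : Fin m → Pos u),
      (t.relabel (Sum.map id Fin.succ)).realize
        (Sum.elim default (Fin.cons (α := fun _ => Pos w) x (e ∘ xs)) : Empty ⊕ _ → Pos w) =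
      e (t.realize (Sum.elim default xs)) := by
    intro m t xs
    obtain ⟨y | y, rfl⟩ := wordLanguage_term t
    · exact y.elim
    · rfl
  induction φ with
  | falsum => exact Iff.rfl
  | equal t₁ t₂ =>
    change _ = _ ↔ _ = _
    rw [hterm, hterm, hinj]
  | rel R ts =>
    cases R with
    | letter a =>
      change (Term.realize _ ((ts 0).relabel (Sum.map id Fin.succ)) : Pos w).label = a ↔
        (Term.realize _ (ts 0) : Pos u).label = a
      rw [hterm, hlabel]
    | lt =>
      change (Term.realize _ ((ts 0).relabel (Sum.map id Fin.succ)) : Pos w).idx <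
        (Term.realize _ ((ts 1).relabel (Sum.map id Fin.succ)) : Pos w).idx ↔
        (Term.realize _ (ts 0) : Pos u).idx < (Term.realize _ (ts 1) : Pos u).idx
      rw [hterm, hterm, hidx, hidx]
      omega
  | imp φ ψ h₁ h₂ =>
    simp only [relativize, BoundedFormula.realize_imp, h₁, h₂]
  | all φ ih =>
    have hsnoc : ∀ p, Fin.snoc (α := fun _ => Pos w)
        (Fin.cons (α := fun _ => Pos w) x (e ∘ xs)) (e p) =
        Fin.cons (α := fun _ => Pos w) x (e ∘ Fin.snoc (α := fun _ => Pos u) xs p) := by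
      intro p
      rw [← Fin.cons_snoc_eq_snoc_cons, Fin.comp_snoc]
    simp only [relativize, BoundedFormula.realize_all, BoundedFormula.realize_imp]
    constructor
    · intro h p
      refine (ih _).1 (hsnoc p ▸ h (e p) ?_)
      rw [realize_sideGuard, Fin.snoc_last]
      exact (hx _).2 ⟨p, rfl⟩
    · intro h y hy
      rw [realize_sideGuard, Fin.snoc_last] at hy
      obtain ⟨p, rfl⟩ := (hx _).1 hy
      exact hsnoc p ▸ (ih _).2 (h p)

theorem InLevel.not {b : Bool} {i m : ℕ} {φ : (wordLanguage A).BoundedFormula Empty m}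
    (h : InLevel (!b) i φ) : InLevel b i φ.not :=
  .imp h (.falsum _ _)

/-- `Σᵢ` is closed under finite conjunctions, at a fixed quantifier rank. -/
theorem exists_conj {i k m : ℕ} (l : List ((wordLanguage A).BoundedFormula Empty m))
    (hl : ∀ φ ∈ l, InLevel true i φ ∧ quantifierRank φ ≤ k) :
    ∃ θ : (wordLanguage A).BoundedFormula Empty m, InLevel true i θ ∧ quantifierRank θ ≤ k ∧
      ∀ (w : FreeMonoid A) (xs : Fin m → Pos w),
        θ.Realize default xs ↔ ∀ φ ∈ l, φ.Realize default xs := by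
  induction l with
  | nil =>
    exact ⟨.imp .falsum .falsum, .imp (.falsum _ _) (.falsum _ _), by simp [quantifierRank],
      fun w xs => by simp [BoundedFormula.Realize]⟩
  | cons φ l ih =>
    obtain ⟨θ, h1, h2, h3⟩ := ih fun ψ hψ => hl ψ (List.mem_cons_of_mem _ hψ)
    obtain ⟨h4, h5⟩ := hl φ List.mem_cons_self
    refine ⟨(φ.imp θ.not).not, .not (.imp h4 (.not h1)), ?_, fun w xs => ?_⟩
    · simp only [quantifierRank, max_le_iff]
      exact ⟨⟨h5, h2, by simp⟩, by simp⟩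
    · simp [BoundedFormula.realize_not, h3]

end Relativize

/-! ### The preorders of the logic and the game -/

section SigmaLE

variable {A : Type*}

open FirstOrder.Language

@[refl]
theorem SigmaLE.refl (i k : ℕ) (w : FreeMonoid A) : SigmaLE i k w w := fun _ _ _ h => h

theorem SigmaLE.trans {i k : ℕ} {u v w : FreeMonoid A} (h₁ : SigmaLE i k u v)
    (h₂ : SigmaLE i k v w) : SigmaLE i k u w := fun φ a b c => h₂ φ a b (h₁ φ a b c)

theorem SigmaLE.mono {i k k' : ℕ} {u v : FreeMonoid A} (h : SigmaLE i k u v) (hk : k' ≤ k) :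
    SigmaLE i k' u v := fun φ a b c => h φ a (b.trans hk) c

theorem SigmaLE.swap {i k : ℕ} {u v : FreeMonoid A} (h : SigmaLE (i + 1) k u v) :
    SigmaLE i k v u := by
  intro φ hφ hk hr
  by_contra hn
  exact h φ.not (.lift (.not hφ)) (by simpa [BoundedFormula.not, quantifierRank] using hk) hn hr

theorem exists_factorization {w : FreeMonoid A} (x : Pos w) :
    ∃ u a v, w = u * FreeMonoid.of a * v ∧ x.label = a ∧ x.idx = u.toList.length := by
  have hx := x.idx_lt
  refine ⟨FreeMonoid.ofList (w.toList.take x.idx), x.label,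
    FreeMonoid.ofList (w.toList.drop (x.idx + 1)), ?_, rfl, ?_⟩
  · apply FreeMonoid.toList.injective
    have h : w.toList[x.idx] = x.label := by
      rw [← Option.some_inj, ← Pos.getElem?_idx, List.getElem?_eq_getElem hx]
    simp only [FreeMonoid.toList_mul, FreeMonoid.toList_ofList, FreeMonoid.toList_of, ← h]
    simp
  · simp only [FreeMonoid.toList_ofList, List.length_take]
    omega

/-- At the marked position of `u * of a * v`, the relativizations of a sentence speak about `u`
and about `v`. -/
theorem realize_at_factorization {u v : FreeMonoid A} {a : A}
    {x : Pos (u * FreeMonoid.of a * v)} (hx : x.idx = u.toList.length) :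
    x.label = a ∧ ∀ φ : (wordLanguage A).Sentence,
      ((relativize true φ).Realize default (fun _ => x) ↔ Sentence.Realize (Pos u) φ) ∧
      ((relativize false φ).Realize default (fun _ => x) ↔ Sentence.Realize (Pos v) φ) := by
  have hl : (u * FreeMonoid.of a * v).toList = u.toList ++ a :: v.toList := by
    simp [FreeMonoid.toList_mul]
  have hlen : (u * FreeMonoid.of a * v).toList.length = u.toList.length + (v.toList.length + 1) := by
    rw [hl]; simp
  have get : ∀ {w : FreeMonoid A} (y : Pos (u * FreeMonoid.of a * v)) (p : Pos w),
      (u.toList ++ a :: v.toList)[y.idx]? = w.toList[p.idx]? → y.label = p.label := by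
    intro w y p h
    rw [← hl, Pos.getElem?_idx, Pos.getElem?_idx] at h
    exact Option.some_inj.1 h
  refine ⟨?_, fun φ => ⟨?_, ?_⟩⟩
  · have h := x.getElem?_idx
    rw [hl, hx] at h
    simpa using h.symm
  · have he : ∀ p : Pos u, ∃ y : Pos (u * FreeMonoid.of a * v), y.idx = p.idx + 0 :=
      fun p => Pos.exists_idx_eq (by have := p.idx_lt; omega)
    choose e he using he
    have := realize_relativize (x := x) true he (fun p => get _ _ (by
      rw [he, Nat.add_zero, List.getElem?_append_left p.idx_lt])) (fun y => ?_) φ default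
    · convert this using 2
      · funext j
        rw [Subsingleton.elim (α := Fin 1) j 0]
        rfl
      · exact Iff.rfl
    · rw [if_pos rfl, hx]
      constructor
      · intro h
        obtain ⟨p, hp⟩ := Pos.exists_idx_eq h
        exact ⟨p, Pos.idx_inj.1 (by rw [he, hp, Nat.add_zero])⟩
      · rintro ⟨p, rfl⟩
        rw [he]
        exact p.idx_lt
  · have he : ∀ p : Pos v, ∃ y : Pos (u * FreeMonoid.of a * v),
        y.idx = p.idx + (u.toList.length + 1) :=
      fun p => Pos.exists_idx_eq (by have := p.idx_lt; omega)
    choose e he using he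
    have := realize_relativize (x := x) false he (fun p => get _ _ (by
      rw [he, List.getElem?_append_right (by omega),
        show p.idx + (u.toList.length + 1) - u.toList.length = p.idx + 1 by omega,
        List.getElem?_cons_succ])) (fun y => ?_) φ default
    · convert this using 2
      · funext j
        rw [Subsingleton.elim (α := Fin 1) j 0]
        rfl
      · exact Iff.rfl
    · rw [if_neg (by simp), hx]
      constructor
      · intro h
        have hy := y.idx_lt
        obtain ⟨p, hp⟩ := Pos.exists_idx_eq (w := v) (p := y.idx - (u.toList.length + 1)) (by omega)
        exact ⟨p, Pos.idx_inj.1 (by rw [he, hp]; omega)⟩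
      · rintro ⟨p, rfl⟩
        rw [he]
        omega

theorem snoc_default {X : Type*} (x : X) :
    (Fin.snoc (α := fun _ => X) (default : Fin 0 → X) x : Fin 1 → X) = fun _ => x := by
  funext j
  rw [Subsingleton.elim (α := Fin 1) j (Fin.last 0), Fin.snoc_last]

/-- A position of the first word is matched by a position of the second one with the same label,
such that the factors on both sides are comparable at the rank below. -/
theorem SigmaLE.split {i k : ℕ} {u v w : FreeMonoid A} {a : A}
    (h : SigmaLE (i + 1) (k + 1) (u * FreeMonoid.of a * v) w) :
    ∃ u' v', w = u' * FreeMonoid.of a * v' ∧ SigmaLE (i + 1) k u u' ∧ SigmaLE (i + 1) k v v' := by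
  -- Otherwise, each position of `w` violates a formula that holds at the marked position of the
  -- first word. As `w` has finitely many positions, the conjunction of these formulas is one.
  by_contra hcon
  push Not at hcon
  obtain ⟨x, hx⟩ : ∃ x : Pos (u * FreeMonoid.of a * v), x.idx = u.toList.length :=
    Pos.exists_idx_eq (by simp)
  obtain ⟨hxa, hxr⟩ := realize_at_factorization hx
  have key : ∀ y : Pos w, ∃ θ : (wordLanguage A).BoundedFormula Empty 1,
      InLevel true (i + 1) θ ∧ quantifierRank θ ≤ k ∧ θ.Realize default (fun _ => x) ∧
        ¬ θ.Realize default (fun _ => y) := by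
    intro y
    by_cases hya : y.label = a
    · obtain ⟨u', a', v', rfl, ha', hy⟩ := exists_factorization y
      obtain rfl : a' = a := ha'.symm.trans hya
      have hyr := (realize_at_factorization hy).2
      by_cases hu : SigmaLE (i + 1) k u u'
      · have hv := hcon u' v' rfl hu
        unfold SigmaLE at hv
        push Not at hv
        obtain ⟨φ, h1, h2, h3, h4⟩ := hv
        exact ⟨relativize false φ, h1.relativize false, by rwa [quantifierRank_relativize],
          (hxr φ).2.2 h3, fun h => h4 ((hyr φ).2.1 h)⟩
      · unfold SigmaLE at hu
        push Not at hu
        obtain ⟨φ, h1, h2, h3, h4⟩ := hu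
        exact ⟨relativize true φ, h1.relativize true, by rwa [quantifierRank_relativize],
          (hxr φ).1.2 h3, fun h => h4 ((hyr φ).1.1 h)⟩
    · exact ⟨.rel (WordRel.letter a : (wordLanguage A).Relations 1) fun _ => .var (.inr 0),
        .rel _ _ _ _, Nat.zero_le _, hxa, hya⟩
  choose θ h1 h2 h3 h4 using key
  obtain ⟨l, hl⟩ : ∃ l : List (Pos w), ∀ y, y ∈ l :=
    ⟨List.finRange w.toList.length, List.mem_finRange⟩
  obtain ⟨ψ, k1, k2, k3⟩ := exists_conj (i := i + 1) (k := k)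
    (l.map θ) (by
      simp only [List.mem_map]
      rintro _ ⟨y, _, rfl⟩
      exact ⟨h1 y, h2 y⟩)
  have hψ : InLevel true (i + 1) (BoundedFormula.not (.all ψ.not)) := .not (.all (.not k1))
  have hr := h _ hψ (by simpa [BoundedFormula.not, quantifierRank] using k2) (by
    intro hall
    refine hall x ?_
    rw [snoc_default, k3]
    simp only [List.mem_map]
    rintro _ ⟨y, _, rfl⟩
    exact h3 y)
  refine hr fun y hy => h4 y ?_
  rw [snoc_default, k3] at hy
  exact hy _ (List.mem_map.2 ⟨y, hl y, rfl⟩)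

theorem wins_diagonal (u : List A) : ∀ (i k : ℕ) (Γ : Set (ℕ × ℕ)),
    (∀ x ∈ Γ, x.1 = x.2 ∧ x.1 < u.length) → Wins i k u u Γ := by
  have base : ∀ Γ : Set (ℕ × ℕ), (∀ x ∈ Γ, x.1 = x.2 ∧ x.1 < u.length) → PartialIso u u Γ := by
    intro Γ h
    refine ⟨fun x hx => ?_, fun x hx y hy => ?_⟩
    · rw [← (h x hx).1]
      exact ⟨(h x hx).2, (h x hx).2, rfl⟩
    · rw [(h x hx).1, (h y hy).1]
  intro i
  induction i with
  | zero => intro k Γ h; rw [Wins]; exact base Γ h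
  | succ i ihi =>
    intro k
    induction k with
    | zero => intro Γ h; rw [Wins]; exact base Γ h
    | succ k ih =>
      intro Γ h
      rw [Wins]
      refine ⟨base Γ h, ihi _ _ fun x hx => ?_, fun p hp => ⟨p, hp, ih _ ?_⟩⟩
      · have := h _ hx
        rw [Prod.fst_swap, Prod.snd_swap] at this
        exact ⟨this.1.symm, this.1 ▸ this.2⟩
      · rintro x (rfl | hx)
        · exact ⟨rfl, hp⟩
        · exact h x hx

theorem partialIso_empty (u v : List A) : PartialIso u v ∅ := by simp [PartialIso]

/-- After one move, the game splits into the games on the two sides of the pebbles. -/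
theorem wins_of_splits {i k : ℕ} {u w : FreeMonoid A} (hs : Wins i (k + 1) w.toList u.toList ∅)
    (h : ∀ u' a u'', u = u' * FreeMonoid.of a * u'' → ∃ w' w'', w = w' * FreeMonoid.of a * w'' ∧
      Wins (i + 1) k u'.toList w'.toList ∅ ∧ Wins (i + 1) k u''.toList w''.toList ∅) :
    Wins (i + 1) (k + 1) u.toList w.toList ∅ := by
  rw [Wins]
  refine ⟨partialIso_empty _ _, by simpa using hs, fun p hp => ?_⟩
  obtain ⟨x, rfl⟩ := Pos.exists_idx_eq hp
  obtain ⟨u', a, u'', rfl, -, hx⟩ := exists_factorization x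
  obtain ⟨w', w'', rfl, h1, h2⟩ := h _ _ _ rfl
  refine ⟨w'.toList.length, by simp, ?_⟩
  rw [hx]
  simp only [FreeMonoid.toList_mul, FreeMonoid.toList_of]
  have hmid : Wins (i + 1) k [a] [a] {(0, 0)} :=
    wins_diagonal _ _ _ _ (by rintro _ rfl; simp)
  refine Wins.append (Wins.append (Γ := {(u'.toList.length, w'.toList.length)}) h1 hmid ?_) h2 ?_
  · rintro _ rfl
    exact Or.inr ⟨_, rfl, rfl⟩
  · rintro y (rfl | hy)
    · exact Or.inl rfl
    · exact hy.elim

/-- The completeness of the game. Splitting provides Duplicator's answer to the first move, and the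
strategies on the two sides of the pebbles are independent of each other. -/
theorem sigmaLE_iff_wins {i : ℕ} : ∀ {k : ℕ} {u v : FreeMonoid A},
    SigmaLE i k u v ↔ Wins i k u.toList v.toList ∅ := by
  intro k u v
  refine ⟨?_, sigmaLE_of_wins⟩
  induction i generalizing k u v with
  | zero => intro _; rw [Wins]; exact partialIso_empty _ _
  | succ i ihi =>
    induction k generalizing u v with
    | zero => intro _; rw [Wins]; exact partialIso_empty _ _
    | succ k ih =>
      intro h
      refine wins_of_splits (ihi h.swap) ?_
      rintro u' a u'' rfl
      obtain ⟨w', w'', e, h1, h2⟩ := h.split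
      exact ⟨w', w'', e, ih h1, ih h2⟩

theorem sigmaLE_of_splits {i k : ℕ} {u w : FreeMonoid A} (hs : SigmaLE i (k + 1) w u)
    (h : ∀ u' a u'', u = u' * FreeMonoid.of a * u'' → ∃ w' w'', w = w' * FreeMonoid.of a * w'' ∧
      SigmaLE (i + 1) k u' w' ∧ SigmaLE (i + 1) k u'' w'') : SigmaLE (i + 1) (k + 1) u w := by
  simp only [sigmaLE_iff_wins] at *
  exact wins_of_splits hs h

theorem SigmaLE.mul {i k : ℕ} {u u' v v' : FreeMonoid A} (h₁ : SigmaLE i k u u')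
    (h₂ : SigmaLE i k v v') : SigmaLE i k (u * v) (u' * v') := by
  rw [sigmaLE_iff_wins] at *
  simp only [FreeMonoid.toList_mul]
  exact Wins.append h₁ h₂ (by simp)

theorem sigmaLE_zero_left (k : ℕ) (u v : FreeMonoid A) : SigmaLE 0 k u v := by
  rw [sigmaLE_iff_wins, Wins]
  exact partialIso_empty _ _

theorem sigmaLE_zero_right (i : ℕ) (u v : FreeMonoid A) : SigmaLE i 0 u v := by
  rw [sigmaLE_iff_wins]
  cases i <;> (rw [Wins]; exact partialIso_empty _ _)

end SigmaLE

/-! ### Contents and powers of words -/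

section Words

variable {A : Type*}

@[simp]
theorem content_one : content (1 : FreeMonoid A) = ∅ := by
  ext a; simp [content]

@[simp]
theorem content_mul (u v : FreeMonoid A) : content (u * v) = content u ∪ content v := by
  ext a; simp [content, FreeMonoid.toList_mul]

@[simp]
theorem content_of (a : A) : content (FreeMonoid.of a) = {a} := by
  ext b; simp [content]

theorem mem_content_iff {a : A} {w : FreeMonoid A} :
    a ∈ content w ↔ ∃ u v, w = u * FreeMonoid.of a * v := by
  constructor
  · intro h
    obtain ⟨s, t, h⟩ := List.append_of_mem (show a ∈ w.toList from h)
    exact ⟨FreeMonoid.ofList s, FreeMonoid.ofList t,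
      FreeMonoid.toList.injective (by simp [FreeMonoid.toList_mul, h])⟩
  · rintro ⟨u, v, rfl⟩
    simp

theorem content_eq_empty_iff {w : FreeMonoid A} : content w = ∅ ↔ w = 1 := by
  refine ⟨fun h => ?_, fun h => by simp [h]⟩
  apply FreeMonoid.toList.injective
  rw [FreeMonoid.toList_one, List.eq_nil_iff_forall_not_mem]
  intro a ha
  have : a ∈ content w := ha
  simp [h] at this

theorem content_pow_of_pos (w : FreeMonoid A) {N : ℕ} (hN : 0 < N) :
    content (w ^ N) = content w := by
  induction N with
  | zero => omega
  | succ N ih =>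
    rw [pow_succ, content_mul]
    rcases Nat.eq_zero_or_pos N with rfl | h
    · simp
    · rw [ih h, Set.union_self]

/-- A position of a product lies in one of the factors. -/
theorem mul_eq_mul_of_mul {x y u v : FreeMonoid A} {a : A} (h : x * y = u * FreeMonoid.of a * v) :
    (∃ t, x = u * FreeMonoid.of a * t ∧ v = t * y) ∨
      ∃ t, y = t * FreeMonoid.of a * v ∧ u = x * t := by
  have h' : x.toList ++ y.toList = u.toList ++ a :: v.toList := by
    have := congrArg FreeMonoid.toList h
    simpa [FreeMonoid.toList_mul] using this
  rcases List.append_eq_append_iff.1 h' with ⟨t, h1, h2⟩ | ⟨t, h1, h2⟩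
  · exact Or.inr ⟨FreeMonoid.ofList t, FreeMonoid.toList.injective (by
      simpa [FreeMonoid.toList_mul] using h2), FreeMonoid.toList.injective (by
      simpa [FreeMonoid.toList_mul] using h1)⟩
  · cases t with
    | nil => exact Or.inr ⟨1, FreeMonoid.toList.injective (by
        simpa [FreeMonoid.toList_mul] using h2.symm), FreeMonoid.toList.injective (by
        simpa [FreeMonoid.toList_mul] using h1.symm)⟩
    | cons b t =>
      rw [List.cons_append, List.cons.injEq] at h2
      obtain ⟨rfl, h2⟩ := h2
      exact Or.inl ⟨FreeMonoid.ofList t, FreeMonoid.toList.injective (by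
        simpa [FreeMonoid.toList_mul] using h1), FreeMonoid.toList.injective (by
        simpa [FreeMonoid.toList_mul] using h2)⟩

/-- A position in a power of `w` lies in one of the copies of `w`. -/
theorem pow_eq_mul_of_mul {w : FreeMonoid A} {a : A} : ∀ {N : ℕ} {u v : FreeMonoid A},
    w ^ N = u * FreeMonoid.of a * v → ∃ c d x y, N = c + 1 + d ∧ w = x * FreeMonoid.of a * y ∧
      u = w ^ c * x ∧ v = y * w ^ d := by
  intro N
  induction N with
  | zero =>
    intro u v h
    have := congrArg content h
    simp only [pow_zero, content_one, content_mul, content_of] at this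
    have h2 : a ∈ (∅ : Set A) := by rw [this]; simp
    exact h2.elim
  | succ N ih =>
    intro u v h
    rw [pow_succ'] at h
    rcases mul_eq_mul_of_mul h with ⟨t, h1, h2⟩ | ⟨t, h1, h2⟩
    · exact ⟨0, N, u, t, by omega, h1, by simp, h2⟩
    · obtain ⟨c, d, x, y, rfl, h3, h4, h5⟩ := ih h1
      exact ⟨c + 1, d, x, y, by omega, h3, by rw [h2, h4, pow_succ', mul_assoc], h5⟩

theorem SigmaLE.content_eq {k : ℕ} {u v : FreeMonoid A} (h : SigmaLE 2 (k + 1) u v) :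
    content u = content v := by
  have key : ∀ {i : ℕ} {u v : FreeMonoid A}, SigmaLE (i + 1) (k + 1) u v →
      content u ⊆ content v := by
    intro i u v h a ha
    obtain ⟨x, y, rfl⟩ := mem_content_iff.1 ha
    obtain ⟨x', y', rfl, -⟩ := h.split
    simp
  exact (key h).antisymm (key h.swap)

theorem SigmaLE.eq_one {k : ℕ} {v : FreeMonoid A} (h : SigmaLE 2 (k + 1) 1 v) : v = 1 :=
  content_eq_empty_iff.1 (by rw [← h.content_eq, content_one])

theorem SigmaLE.eq_of {k : ℕ} {a : A} {v : FreeMonoid A}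
    (h : SigmaLE 2 (k + 2) (FreeMonoid.of a) v) : v = FreeMonoid.of a := by
  rw [← one_mul (FreeMonoid.of a), ← mul_one (1 * FreeMonoid.of a)] at h
  obtain ⟨x, y, rfl, h1, h2⟩ := h.split
  rw [h1.eq_one, h2.eq_one, one_mul, mul_one]

/-- A power of `w` with an exponent exponential in `k` contains what an existential formula of rank
`k` can say about a word over the content of `w`: each move is answered in a copy of `w` in the
middle. -/
theorem sigmaLE_one_pow {w : FreeMonoid A} {k : ℕ} : ∀ {N : ℕ} {x y z : FreeMonoid A},
    content x ⊆ content w → 2 ^ k ≤ N + 1 → SigmaLE 1 k x (y * w ^ N * z) := by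
  induction k with
  | zero => intros; exact sigmaLE_zero_right _ _ _
  | succ k ih =>
    intro N x y z hx hN
    refine sigmaLE_of_splits (sigmaLE_zero_left _ _ _) ?_
    rintro x₁ a x₂ rfl
    simp only [content_mul, content_of, Set.union_subset_iff, Set.singleton_subset_iff] at hx
    obtain ⟨w₁, w₂, hw⟩ := mem_content_iff.1 hx.1.2
    obtain ⟨d, rfl⟩ : ∃ d, N = (2 ^ k - 1) + 1 + d :=
      ⟨N - 2 ^ k, by have := Nat.one_le_two_pow (n := k); rw [pow_succ] at hN; omega⟩
    refine ⟨y * w ^ (2 ^ k - 1) * w₁, w₂ * w ^ d * z, ?_, ih hx.1.1 (by omega), ih hx.2 ?_⟩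
    · rw [pow_add, pow_add, pow_one]
      nth_rw 2 [hw]
      simp only [mul_assoc]
    · rw [pow_succ] at hN
      omega

/-- The preorder of `Σ₂` allows the insertion of any word over the content of `w` into the middle
of a high power of `w`. -/
theorem sigmaLE_two_pow {w : FreeMonoid A} {k : ℕ} :
    ∀ {N N₁ N₂ : ℕ} {v : FreeMonoid A}, content v ⊆ content w →
      4 ^ k ≤ N → 4 ^ k ≤ N₁ → 4 ^ k ≤ N₂ → SigmaLE 2 k (w ^ N) (w ^ N₁ * v * w ^ N₂) := by
  induction k with
  | zero => intros; exact sigmaLE_zero_right _ _ _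
  | succ k ih =>
    intro N N₁ N₂ v hv hN h₁ h₂
    have hk : 1 ≤ 4 ^ k := Nat.one_le_pow _ _ (by norm_num)
    rw [pow_succ] at hN h₁ h₂
    refine sigmaLE_of_splits ?_ ?_
    · have hle : 2 ^ (k + 1) ≤ N + 1 := by
        have : 2 ^ k ≤ 4 ^ k := Nat.pow_le_pow_left (by norm_num) k
        rw [pow_succ]
        omega
      have := sigmaLE_one_pow (w := w) (N := N) (x := w ^ N₁ * v * w ^ N₂) (y := 1) (z := 1)
        (by
          rw [content_mul, content_mul, content_pow_of_pos _ (by omega),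
            content_pow_of_pos _ (by omega)]
          simp [hv]) hle
      simpa using this
    · rintro u₁ a u₂ hu
      obtain ⟨c, d, x, y, rfl, hw, rfl, rfl⟩ := pow_eq_mul_of_mul hu
      -- The copy of `w` with the chosen position keeps its distance from the nearer end; in the
      -- middle, it is moved away from `v` and from both ends.
      have hcopy : ∀ e f : ℕ, w ^ (e + 1 + f) = w ^ e * x * FreeMonoid.of a * (y * w ^ f) := by
        intro e f
        rw [pow_add, pow_succ]
        nth_rw 2 [hw]
        simp only [mul_assoc]
      by_cases hc : c < 4 ^ k
      · obtain ⟨e, rfl⟩ : ∃ e, N₁ = c + 1 + e := ⟨N₁ - (c + 1), by omega⟩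
        refine ⟨w ^ c * x, y * (w ^ e * v * w ^ N₂), ?_, .refl _ _ _,
          .mul (.refl _ _ _) (ih hv (by omega) (by omega) (by omega))⟩
        rw [hcopy]
        simp only [mul_assoc]
      by_cases hd : d < 4 ^ k
      · obtain ⟨e, rfl⟩ : ∃ e, N₂ = e + 1 + d := ⟨N₂ - (d + 1), by omega⟩
        refine ⟨w ^ N₁ * v * w ^ e * x, y * w ^ d, ?_,
          .mul (ih hv (by omega) (by omega) (by omega)) (.refl _ _ _), .refl _ _ _⟩
        rw [hcopy]
        simp only [mul_assoc]
      · obtain ⟨e, rfl⟩ : ∃ e, N₁ = (4 ^ k + 4 ^ k) + 1 + e :=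
          ⟨N₁ - (4 ^ k + 4 ^ k + 1), by omega⟩
        refine ⟨w ^ (4 ^ k + 4 ^ k) * x, y * (w ^ e * v * w ^ N₂), ?_, .mul ?_ (.refl _ _ _),
          .mul (.refl _ _ _) (ih hv (by omega) (by omega) (by omega))⟩
        · rw [hcopy]
          simp only [mul_assoc]
        · have := ih (N := c) (N₁ := 4 ^ k) (N₂ := 4 ^ k) (v := 1) (by simp) (by omega) le_rfl le_rfl
          rwa [mul_one, ← pow_add] at this

end Words

/-! ### Chains of words -/

section Chains

variable {A M : Type*} [Monoid M]

theorem SigmaLE.split_mul {i k : ℕ} {x y w : FreeMonoid A}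
    (h : SigmaLE (i + 1) (k + 1) (x * y) w) :
    ∃ x' y', w = x' * y' ∧ SigmaLE (i + 1) k x x' ∧ SigmaLE (i + 1) k y y' := by
  obtain rfl | ⟨t, a, rfl⟩ : x = 1 ∨ ∃ t a, x = t * FreeMonoid.of a := by
    rcases List.eq_nil_or_concat x.toList with h | ⟨t, a, h⟩
    · exact Or.inl (FreeMonoid.toList.injective (by simpa using h))
    · exact Or.inr ⟨FreeMonoid.ofList t, a,
        FreeMonoid.toList.injective (by simpa [FreeMonoid.toList_mul] using h)⟩
  · exact ⟨1, w, (one_mul w).symm, .refl _ _ _, by simpa using h.mono (Nat.le_succ k)⟩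
  · obtain ⟨t', y', rfl, h1, h2⟩ := h.split
    exact ⟨t' * FreeMonoid.of a, y', rfl, h1.mul (.refl _ _ _), h2⟩

theorem IsSigmaTwoChain.mono {k k' n : ℕ} {u : Fin n → FreeMonoid A} (h : IsSigmaTwoChain k u)
    (hk : k' ≤ k) : IsSigmaTwoChain k' u := fun i j hij => (h i j hij).mono hk

theorem IsSigmaTwoChain.mul {k n : ℕ} {u v : Fin n → FreeMonoid A} (hu : IsSigmaTwoChain k u)
    (hv : IsSigmaTwoChain k v) : IsSigmaTwoChain k (u * v) :=
  fun i j hij => (hu i j hij).mul (hv i j hij)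

theorem isSigmaTwoChain_const (k n : ℕ) (w : FreeMonoid A) :
    IsSigmaTwoChain k (fun _ : Fin n => w) := fun _ _ _ => .refl _ _ _

theorem isSigmaTwoChain_cons {k n : ℕ} {w : FreeMonoid A} {u : Fin (n + 1) → FreeMonoid A} :
    IsSigmaTwoChain k (Fin.cons w u : Fin (n + 2) → FreeMonoid A) ↔
      SigmaLE 2 k w (u 0) ∧ IsSigmaTwoChain k u := by
  constructor
  · intro h
    refine ⟨h 0 1 rfl, fun i j hij => ?_⟩
    exact h i.succ j.succ (by simp [hij])
  · rintro ⟨h0, h⟩ i j hij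
    obtain ⟨j, rfl⟩ : ∃ j', j = Fin.succ j' := ⟨j.pred (by rintro rfl; simp at hij), by simp⟩
    induction i using Fin.cases with
    | zero =>
      obtain rfl : j = 0 := Fin.ext (by simpa using hij)
      exact h0
    | succ i =>
      exact h i j (by simpa using hij)

theorem IsSigmaTwoChain.le_of_zero {k n : ℕ} {u : Fin (n + 1) → FreeMonoid A}
    (h : IsSigmaTwoChain k u) (j : Fin (n + 1)) : SigmaLE 2 k (u 0) (u j) := by
  induction j using Fin.induction with
  | zero => exact .refl _ _ _
  | succ j ih => exact ih.trans (h _ _ (by simp))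

/-- A factorization of the first word propagates along the chain. The rank drops by one only, as the
next word is compared with the product of the factors at the original rank. -/
theorem IsSigmaTwoChain.split {k : ℕ} : ∀ {n : ℕ} {u : Fin (n + 1) → FreeMonoid A}
    {x y : FreeMonoid A}, IsSigmaTwoChain (k + 1) u → u 0 = x * y →
    ∃ X Y : Fin (n + 1) → FreeMonoid A, X 0 = x ∧ Y 0 = y ∧ IsSigmaTwoChain k X ∧
      IsSigmaTwoChain k Y ∧ u = X * Y := by
  intro n
  induction n with
  | zero =>
    intro u x y _ h0
    refine ⟨fun _ => x, fun _ => y, rfl, rfl, isSigmaTwoChain_const _ _ _,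
      isSigmaTwoChain_const _ _ _, ?_⟩
    funext j
    rw [Subsingleton.elim (α := Fin 1) j 0, h0]
    rfl
  | succ n ih =>
    intro u x y h h0
    rw [← Fin.cons_self_tail u] at h ⊢
    obtain ⟨h1, h2⟩ := isSigmaTwoChain_cons.1 h
    rw [h0] at h1 ⊢
    obtain ⟨x', y', e, hx, hy⟩ := h1.split_mul
    obtain ⟨X, Y, rfl, rfl, hX, hY, hXY⟩ := ih h2 e
    refine ⟨Fin.cons x X, Fin.cons y Y, rfl, rfl, isSigmaTwoChain_cons.2 ⟨hx, hX⟩,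
      isSigmaTwoChain_cons.2 ⟨hy, hY⟩, ?_⟩
    rw [hXY]
    funext j
    induction j using Fin.cases <;> rfl

/-- The images under `α` of the chains of length `n + 1` for `Σ₂[k]` that start with `w`. -/
def chainSet (α : FreeMonoid A →* M) (n k : ℕ) (w : FreeMonoid A) : Set (Fin (n + 1) → M) :=
  {s | ∃ u : Fin (n + 1) → FreeMonoid A, u 0 = w ∧ IsSigmaTwoChain k u ∧ ∀ j, α (u j) = s j}

variable {α : FreeMonoid A →* M} {n k : ℕ}

theorem chainSet_anti {k' : ℕ} (hk : k' ≤ k) (w : FreeMonoid A) :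
    chainSet α n k w ⊆ chainSet α n k' w := fun _ ⟨u, h0, h, hs⟩ => ⟨u, h0, h.mono hk, hs⟩

theorem apply_zero_of_mem_chainSet {w : FreeMonoid A} {s : Fin (n + 1) → M}
    (hs : s ∈ chainSet α n k w) : s 0 = α w := by
  obtain ⟨u, rfl, -, hs⟩ := hs
  exact (hs 0).symm

theorem chainSet_mul_subset (x y : FreeMonoid A) :
    chainSet α n (k + 1) (x * y) ⊆ chainSet α n k x * chainSet α n k y := by
  rintro s ⟨u, h0, h, hs⟩
  obtain ⟨X, Y, hX0, hY0, hX, hY, rfl⟩ := h.split h0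
  refine Set.mem_mul.2 ⟨fun j => α (X j), ⟨X, hX0, hX, fun _ => rfl⟩, fun j => α (Y j),
    ⟨Y, hY0, hY, fun _ => rfl⟩, ?_⟩
  funext j
  rw [← hs j]
  simp

theorem chainSet_one_subset : chainSet α n (k + 1) 1 ⊆ {1} := by
  rintro s ⟨u, h0, h, hs⟩
  rw [Set.mem_singleton_iff]
  funext j
  have := h.le_of_zero j
  rw [h0] at this
  rw [← hs j, this.eq_one, map_one]
  rfl

theorem chainSet_of_subset (a : A) :
    chainSet α n (k + 2) (FreeMonoid.of a) ⊆ {fun _ => α (FreeMonoid.of a)} := by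
  rintro s ⟨u, h0, h, hs⟩
  rw [Set.mem_singleton_iff]
  funext j
  have := h.le_of_zero j
  rw [h0] at this
  rw [← hs j, this.eq_of]

theorem mem_compatRank_iff {B : Set A} {T : Set (Fin (n + 1) → M)} :
    T ∈ compatRank α (n + 1) (k + 1) B ↔ ∃ w, content w = B ∧ T ⊆ chainSet α n (k + 1) w := by
  constructor
  · rintro ⟨w, hw, h⟩
    refine ⟨w, hw, fun s hs => ?_⟩
    obtain ⟨u, h0, hu, hs, -⟩ := h s hs
    exact ⟨u, h0 0 rfl, hu, hs⟩
  · rintro ⟨w, hw, h⟩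
    refine ⟨w, hw, fun s hs => ?_⟩
    obtain ⟨u, h0, hu, hs⟩ := h hs
    refine ⟨u, fun j hj => ?_, hu, hs, fun j => ?_⟩
    · rw [← h0]; exact congrArg u (Fin.ext hj)
    · rw [← (hu.le_of_zero j).content_eq, h0, hw]

theorem compatRank_anti {k' : ℕ} (hk : k' ≤ k) (n : ℕ) (B : Set A) :
    compatRank α n k B ⊆ compatRank α n k' B := by
  rintro T ⟨w, hw, h⟩
  refine ⟨w, hw, fun s hs => ?_⟩
  obtain ⟨u, h0, hu, h1, h2⟩ := h s hs
  exact ⟨u, h0, hu.mono hk, h1, h2⟩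

theorem mem_chainsRank_iff {B : Set A} {s : Fin (n + 1) → M} :
    s ∈ chainsRank α (n + 1) k B ↔ {s} ∈ compatRank α (n + 1) k B := by
  constructor
  · rintro ⟨u, h1, h2, h3⟩
    refine ⟨u 0, h3 0, ?_⟩
    rintro _ rfl
    exact ⟨u, fun j hj => congrArg u (Fin.ext hj), h1, h2, h3⟩
  · rintro ⟨w, hw, h⟩
    obtain ⟨u, -, h1, h2, h3⟩ := h s rfl
    exact ⟨u, h1, h2, h3⟩

/-- The tails of the chains that start with `w` are chains for the content of `w`. -/
theorem tail_mem_chainsRank {w : FreeMonoid A} {s : Fin (n + 2) → M}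
    (hs : s ∈ chainSet α (n + 1) (k + 1) w) :
    Fin.tail s ∈ chainsRank α (n + 1) (k + 1) (content w) := by
  obtain ⟨u, h0, h, hs⟩ := hs
  refine ⟨Fin.tail u, fun i j hij => h _ _ (by simp [hij]), fun j => hs _, fun j => ?_⟩
  rw [Fin.tail, ← (h.le_of_zero _).content_eq, h0]

end Chains

/-! ### Soundness of the saturation -/

section Soundness

variable {A M : Type*} [Monoid M] {α : FreeMonoid A →* M} {n k : ℕ}

theorem chainSet_mul_chainSet_subset (x y : FreeMonoid A) :
    chainSet α n k x * chainSet α n k y ⊆ chainSet α n k (x * y) := by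
  rintro _ ⟨s, ⟨u, hu0, hu, hs⟩, t, ⟨v, hv0, hv, ht⟩, rfl⟩
  exact ⟨u * v, by simp [hu0, hv0], hu.mul hv, fun j => by simp [hs, ht]⟩

theorem one_mem_chainSet_one : (1 : Fin (n + 1) → M) ∈ chainSet α n k 1 :=
  ⟨fun _ => 1, rfl, isSigmaTwoChain_const _ _ _, fun _ => by simp⟩

theorem chainSet_pow_subset (w : FreeMonoid A) (N : ℕ) :
    chainSet α n k w ^ N ⊆ chainSet α n k (w ^ N) := by
  induction N with
  | zero =>
    rw [pow_zero, pow_zero, Set.one_subset]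
    exact one_mem_chainSet_one
  | succ N ih =>
    rw [pow_succ, pow_succ]
    exact (Set.mul_subset_mul_right ih).trans (chainSet_mul_chainSet_subset _ _)

theorem mem_compat_iff {B : Set A} {T : Set (Fin (n + 1) → M)} :
    T ∈ compat α (n + 1) B ↔
      ∀ k, ∃ w, content w = B ∧ T ⊆ chainSet α n (k + 1) w :=
  ⟨fun h k => mem_compatRank_iff.1 (h (k + 1)),
    fun h k => compatRank_anti (Nat.le_succ k) _ _ (mem_compatRank_iff.2 (h k))⟩

theorem trivialSets_subset_compat (B : Set A) :
    trivialSets α (n + 1) B ⊆ compat α (n + 1) B := by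
  rintro _ ⟨w, hw, rfl⟩
  rw [mem_compat_iff]
  rintro k
  refine ⟨w, hw, ?_⟩
  rintro _ rfl
  exact ⟨fun _ => w, rfl, isSigmaTwoChain_const _ _ _, fun _ => rfl⟩

theorem mul_mem_compat {C D : Set A} {S T : Set (Fin (n + 1) → M)}
    (hS : S ∈ compat α (n + 1) C) (hT : T ∈ compat α (n + 1) D) :
    S * T ∈ compat α (n + 1) (C ∪ D) := by
  rw [mem_compat_iff] at *
  intro k
  obtain ⟨x, rfl, hx⟩ := hS k
  obtain ⟨y, rfl, hy⟩ := hT k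
  exact ⟨x * y, content_mul _ _,
    (Set.mul_subset_mul hx hy).trans (chainSet_mul_chainSet_subset _ _)⟩

theorem compat_subset_compat_of_subset {B : Set A} {S T : Set (Fin n → M)} (h : S ⊆ T)
    (hT : T ∈ compat α n B) : S ∈ compat α n B := fun k =>
  let ⟨w, hw, hk⟩ := hT k
  ⟨w, hw, fun s hs => hk s (h hs)⟩

/-- The set `(1, C)` of the tuples that start with `1` and continue with a chain for `(α, B)`. -/
def oneChains (α : FreeMonoid A →* M) (n : ℕ) (B : Set A) : Set (Fin (n + 2) → M) :=
  (fun s : Fin (n + 1) → M => (Fin.cons 1 s : Fin (n + 2) → M)) '' chains α (n + 1) B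

theorem omega_mem_compat [Finite M] {B : Set A} {T : Set (Fin (n + 2) → M)}
    (hT : T ∈ compat α (n + 2) B) :
    T ^ omegaExp (Set (Fin (n + 2) → M)) * oneChains α n B *
      T ^ omegaExp (Set (Fin (n + 2) → M)) ∈ compat α (n + 2) B := by
  set ω := omegaExp (Set (Fin (n + 2) → M)) with hω
  obtain ⟨hpos, hidem⟩ := omegaExp_spec (Set (Fin (n + 2) → M))
  rw [mem_compat_iff] at *
  intro k
  obtain ⟨w, rfl, hw⟩ := hT k
  -- The power `T ^ ω` is the power of `T` to an exponent that the formulas of rank `k + 1` cannot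
  -- distinguish from larger ones.
  set N := ω * 4 ^ (k + 1) with hN
  have h4 : 1 ≤ 4 ^ (k + 1) := Nat.one_le_pow _ _ (by norm_num)
  have hN4 : 4 ^ (k + 1) ≤ N := Nat.le_mul_of_pos_left _ hpos
  have hTN : T ^ ω = T ^ N := by
    rw [hN, pow_mul]
    obtain ⟨r, hr⟩ : ∃ r, 4 ^ (k + 1) = r + 1 := ⟨4 ^ (k + 1) - 1, by omega⟩
    rw [hr, (hidem T).pow_succ_eq]
  have hTw : T ^ ω ⊆ chainSet α (n + 1) (k + 1) (w ^ N) := by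
    rw [hTN]
    exact (Set.pow_subset_pow_left hw).trans (chainSet_pow_subset _ _)
  refine ⟨w ^ N * w ^ N, by
    rw [content_mul, content_pow_of_pos _ (by omega), Set.union_self], ?_⟩
  rintro _ ⟨_, ⟨t, ht, _, ⟨s, hs, rfl⟩, rfl⟩, t', ht', rfl⟩
  obtain ⟨u, hu0, hu, hut⟩ := hTw ht
  obtain ⟨u', hu0', hu', hut'⟩ := hTw ht'
  obtain ⟨v, hv, hvs, hvc⟩ := hs (k + 1)
  rw [← Fin.cons_self_tail u, isSigmaTwoChain_cons, hu0] at hu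
  rw [← Fin.cons_self_tail u', isSigmaTwoChain_cons, hu0'] at hu'
  refine ⟨Fin.cons (w ^ N * w ^ N) (Fin.tail u * v * Fin.tail u'), rfl,
    isSigmaTwoChain_cons.2 ⟨?_, (hu.2.mul hv).mul hu'.2⟩, fun j => ?_⟩
  · refine SigmaLE.trans ?_ ((hu.1.mul (.refl _ _ (v 0))).mul hu'.1)
    rw [← pow_add]
    exact sigmaLE_two_pow (hvc 0).le (by omega) hN4 hN4
  · induction j using Fin.cases with
    | zero => simp [← hut, ← hut', hu0, hu0']
    | succ j => simp [← hut, ← hut', ← hvs, Fin.tail]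

theorem satStar_subset_compat [Finite A] [Finite M] (B : Set A) :
    satStar α (n + 1) (fun C => trivialSets α (n + 1) C) B ⊆ compat α (n + 1) B := by
  intro T hT
  obtain ⟨j, hj⟩ := (mem_satStar_iff _ _ _ _ _).1 hT
  clear hT
  induction j generalizing B T with
  | zero => exact trivialSets_subset_compat B hj
  | succ j ih =>
    rw [Function.iterate_succ_apply'] at hj
    cases n with
    | zero => exact ih _ hj
    | succ n =>
      rcases hj with (hj | ⟨C, D, rfl, S, hS, T, hT, rfl⟩) | ⟨T, hT, rfl⟩
      · exact ih _ hj
      · exact mul_mem_compat (ih _ hS) (ih _ hT)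
      · exact omega_mem_compat (ih _ hT)

end Soundness

/-! ### Repetitions in long products -/

section Repetition

variable {N X : Type*} [Monoid N]

theorem mul_pow_eq_of_mul_eq {p z : N} (h : p * z = p) (r : ℕ) : p * z ^ r = p := by
  induction r with
  | zero => simp
  | succ r ih => rw [pow_succ, ← mul_assoc, ih, h]

theorem pow_mul_eq_of_mul_eq {p z : N} (h : z * p = p) (r : ℕ) : z ^ r * p = p := by
  induction r with
  | zero => simp
  | succ r ih => rw [pow_succ, mul_assoc, h, ih]

/-- A list that is long in comparison with a finite monoid has a nonempty factor whose product
can be repeated on both sides without changing the products of its neighbourhood. The two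
conditions come from one application of the pigeonhole principle to the pairs of the products on
the left and on the right of a cut. -/
theorem exists_absorbed_factor [Finite N] (f : X → N) (l : List X)
    (hl : Nat.card N ^ 2 ≤ l.length) :
    ∃ l₁ z l₃ l₄, l = l₁ ++ (z ++ (l₃ ++ l₄)) ∧ z ≠ [] ∧
      l₁.length + z.length + l₃.length ≤ Nat.card N ^ 2 ∧
      (l₁.map f).prod * (z.map f).prod = (l₁.map f).prod ∧
      (z.map f).prod * (l₃.map f).prod = (l₃.map f).prod := by
  set D := Nat.card N ^ 2 with hD
  let g : Fin (D + 1) → N × N := fun i =>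
    (((l.take i).map f).prod, (((l.take D).drop i).map f).prod)
  obtain ⟨i, j, hij, h⟩ : ∃ i j : Fin (D + 1), i < j ∧ g i = g j := by
    by_contra hcon
    push Not at hcon
    have hinj : Function.Injective g := by
      intro i j h
      rcases lt_trichotomy i j with hlt | heq | hlt
      · exact (hcon _ _ hlt h).elim
      · exact heq
      · exact (hcon _ _ hlt h.symm).elim
    have := Nat.card_le_card_of_injective g hinj
    rw [Nat.card_prod, ← sq, ← hD, Nat.card_eq_fintype_card, Fintype.card_fin] at this
    omega
  have hlt : i.val < j.val := hij
  have hj : j.val ≤ D := Nat.lt_succ_iff.1 j.isLt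
  obtain ⟨h1, h2⟩ := Prod.ext_iff.1 h
  dsimp only [g] at h1 h2
  have e1 : l.take j = l.take i ++ (l.take j).drop i := by
    conv_lhs => rw [← List.take_append_drop i (l.take j), List.take_take, min_eq_left hlt.le]
  have e2 : (l.take D).drop i = (l.take j).drop i ++ (l.take D).drop j := by
    conv_lhs => rw [← List.take_append_drop (j - i) ((l.take D).drop i)]
    rw [List.drop_drop, ← List.drop_take, List.take_take, min_eq_left hj]
    rw [show i.val + (j.val - i.val) = j by omega]
  refine ⟨l.take i, (l.take j).drop i, (l.take D).drop j, l.drop D, ?_, ?_, ?_, ?_, ?_⟩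
  · rw [← List.append_assoc _ _ (l.drop D), ← e2, ← List.append_assoc]
    conv_lhs => rw [← List.take_append_drop D l]
    congr 1
    conv_lhs => rw [← List.take_append_drop i (l.take D), List.take_take,
      min_eq_left (hlt.le.trans hj)]
  · intro hnil
    have := congrArg List.length hnil
    simp at this
    omega
  · simp
    omega
  · rw [← List.prod_append, ← List.map_append, ← e1, h1]
  · rw [← List.prod_append, ← List.map_append, ← e2, h2]

end Repetition

/-! ### Completeness of the saturation -/

section Completeness

variable {A M : Type*} [Monoid M] {α : FreeMonoid A →* M} {m k : ℕ}

/-- A family of sets of tuples with the closure properties of the result of the procedure. -/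
structure IsSaturated (α : FreeMonoid A →* M) (𝒮 : Set A → Set (Set (Fin (m + 2) → M))) :
    Prop where
  const_mem : ∀ w, {fun _ => α w} ∈ 𝒮 (content w)
  mul_mem : ∀ {C D S T}, S ∈ 𝒮 C → T ∈ 𝒮 D → S * T ∈ 𝒮 (C ∪ D)
  omega_mem : ∀ {B T}, T ∈ 𝒮 B → T ^ omegaExp (Set (Fin (m + 2) → M)) * oneChains α m B *
      T ^ omegaExp (Set (Fin (m + 2) → M)) ∈ 𝒮 B

theorem isSaturated_satStar [Finite A] [Finite M] (α : FreeMonoid A →* M) (m : ℕ) :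
    IsSaturated α (satStar α (m + 2) fun C => trivialSets α (m + 2) C) where
  const_mem w := (mem_satStar_iff _ _ _ _ _).2 ⟨0, w, rfl, rfl⟩
  mul_mem {C D S T} hS hT := by
    rw [← sat_satStar]
    exact Or.inl (Or.inr ⟨C, D, rfl, Set.mul_mem_mul hS hT⟩)
  omega_mem {B T} hT := by
    rw [← sat_satStar]
    exact Or.inr ⟨T, hT, rfl⟩

theorem IsSaturated.one_mem {𝒮 : Set A → Set (Set (Fin (m + 2) → M))} (h : IsSaturated α 𝒮) :
    1 ∈ 𝒮 ∅ := by
  have := h.const_mem 1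
  rw [content_one, map_one] at this
  exact this

/-- The tuples of `E` are in `S`, up to a change of their first entry that is invisible after a
multiplication by `p` on the left. -/
def Covers {n : ℕ} (p : M) (E S : Set (Fin (n + 1) → M)) : Prop :=
  ∀ s ∈ E, ∃ s' ∈ S, p * s' 0 = p * s 0 ∧ Fin.tail s' = Fin.tail s

theorem tail_mul {n : ℕ} (s t : Fin (n + 1) → M) : Fin.tail (s * t) = Fin.tail s * Fin.tail t := rfl

theorem Covers.of_subset {n : ℕ} {p : M} {E S : Set (Fin (n + 1) → M)} (h : E ⊆ S) :
    Covers p E S := fun s hs => ⟨s, h hs, rfl, rfl⟩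

theorem Covers.subset {n : ℕ} {E S : Set (Fin (n + 1) → M)} (h : Covers 1 E S) : E ⊆ S := by
  intro s hs
  obtain ⟨s', hs', h0, ht⟩ := h s hs
  rw [one_mul, one_mul] at h0
  rwa [← Fin.cons_self_tail s, ← h0, ← ht, Fin.cons_self_tail]

theorem Covers.mono {n : ℕ} {p : M} {E E' S : Set (Fin (n + 1) → M)} (h : Covers p E S)
    (hE : E' ⊆ E) : Covers p E' S := fun s hs => h s (hE hs)

theorem Covers.mul {n : ℕ} {p a : M} {E₁ E₂ S₁ S₂ : Set (Fin (n + 1) → M)} (h₁ : Covers p E₁ S₁)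
    (ha : ∀ s ∈ E₁, s 0 = a) (h₂ : Covers (p * a) E₂ S₂) : Covers p (E₁ * E₂) (S₁ * S₂) := by
  rintro _ ⟨s, hs, t, ht, rfl⟩
  obtain ⟨s', hs', h1, h2⟩ := h₁ s hs
  obtain ⟨t', ht', h3, h4⟩ := h₂ t ht
  refine ⟨s' * t', Set.mul_mem_mul hs' ht', ?_, by simp only [tail_mul, h2, h4]⟩
  simp only [Pi.mul_apply, ← mul_assoc, h1]
  rw [ha s hs, h3]

/-- A factor of a word whose surroundings absorb powers of `Z` on both sides is covered by
`Z ^ ω (1, C) Z ^ ω`, if its value is invisible after the value of the prefix before it. -/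
theorem covers_omega {p a b : M} {B : Set A} {P Z R E₁ E₂ E₃ : Set (Fin (m + 2) → M)} (r : ℕ)
    (hP : P * Z = P) (hR : Z * R = R) (h₁ : E₁ ⊆ P) (h₃ : E₃ ⊆ R) (ha : ∀ s ∈ E₁, s 0 = a)
    (hb : ∀ s ∈ E₂, s 0 = b) (hab : p * a * b = p * a)
    (h₂ : ∀ s ∈ E₂, Fin.tail s ∈ chains α (m + 1) B) :
    Covers p (E₁ * E₂ * E₃) (P * (Z ^ r * oneChains α m B * Z ^ r) * R) := by
  rintro _ ⟨_, ⟨s₁, hs₁, s₂, hs₂, rfl⟩, s₃, hs₃, rfl⟩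
  have hs₁' := h₁ hs₁
  have hs₃' := h₃ hs₃
  rw [← mul_pow_eq_of_mul_eq hP r] at hs₁'
  rw [← pow_mul_eq_of_mul_eq hR r] at hs₃'
  obtain ⟨q, hq, t, ht, hqt⟩ := Set.mem_mul.1 hs₁'
  obtain ⟨t', ht', q', hq', hqt'⟩ := Set.mem_mul.1 hs₃'
  refine ⟨q * (t * (Fin.cons 1 (Fin.tail s₂) : Fin (m + 2) → M) * t') * q',
    Set.mul_mem_mul (Set.mul_mem_mul hq (Set.mul_mem_mul (Set.mul_mem_mul ht
      ⟨_, h₂ s₂ hs₂, rfl⟩) ht')) hq', ?_, ?_⟩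
  · have h0 := ha s₁ hs₁
    rw [← hqt, Pi.mul_apply] at h0
    dsimp only
    rw [Pi.mul_apply, Pi.mul_apply, Pi.mul_apply, Pi.mul_apply, Fin.cons_zero, mul_one,
      Pi.mul_apply, Pi.mul_apply, ha s₁ hs₁, hb s₂ hs₂, ← hqt', Pi.mul_apply]
    calc p * (q 0 * (t 0 * t' 0) * q' 0) = p * (q 0 * t 0) * (t' 0 * q' 0) := by
          simp only [mul_assoc]
      _ = p * a * b * (t' 0 * q' 0) := by rw [h0, hab]
      _ = p * (a * b * (t' 0 * q' 0)) := by simp only [mul_assoc]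
  · simp only [tail_mul, ← hqt, ← hqt', Fin.tail_cons, mul_assoc]

section Sequences

variable {B : Set A} {𝒮 : Set A → Set (Set (Fin (m + 2) → M))} {k₀ : ℕ}
  {T : FreeMonoid A → Set (Fin (m + 2) → M)}

theorem chainSet_prod_subset (hk₀ : 1 ≤ k₀) {k : ℕ} {l : List (FreeMonoid A)}
    (hl : ∀ y ∈ l, chainSet α (m + 1) k₀ y ⊆ T y) (hk : k₀ + l.length ≤ k) :
    chainSet α (m + 1) k l.prod ⊆ (l.map T).prod := by
  refine (chainSet_anti hk _).trans ?_
  clear hk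
  induction l with
  | nil =>
    obtain ⟨k₀, rfl⟩ : ∃ k', k₀ = k' + 1 := ⟨k₀ - 1, by omega⟩
    exact chainSet_one_subset
  | cons y l ih =>
    rw [List.prod_cons, List.map_cons, List.prod_cons, List.length_cons, ← add_assoc]
    refine (chainSet_mul_subset _ _).trans (Set.mul_subset_mul
      ((chainSet_anti (Nat.le_add_right _ _) _).trans (hl y List.mem_cons_self))
      (ih fun z hz => hl z (List.mem_cons_of_mem _ hz)))

theorem content_list_prod {l : List (FreeMonoid A)} (hl : ∀ y ∈ l, content y = B) (h : l ≠ []) :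
    content l.prod = B := by
  induction l with
  | nil => exact (h rfl).elim
  | cons y l ih =>
    rw [List.prod_cons, content_mul, hl y List.mem_cons_self]
    by_cases hnil : l = []
    · simp [hnil]
    · rw [ih (fun z hz => hl z (List.mem_cons_of_mem _ hz)) hnil, Set.union_self]

theorem IsSaturated.list_prod_mem (h𝒮 : IsSaturated α 𝒮) {l : List (FreeMonoid A)}
    (hl : ∀ y ∈ l, T y ∈ 𝒮 B) (h : l ≠ []) : (l.map T).prod ∈ 𝒮 B := by
  induction l with
  | nil => exact (h rfl).elim
  | cons y l ih =>
    rw [List.map_cons, List.prod_cons]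
    have hy := hl y List.mem_cons_self
    by_cases hnil : l = []
    · simpa [hnil] using hy
    · have := h𝒮.mul_mem hy (ih (fun z hz => hl z (List.mem_cons_of_mem _ hz)) hnil)
      rwa [Set.union_self] at this

/-- The marks of the cuts of a list of words, read after a word of value `p`: a cut has the mark
`(Z, q)` if `q` is the value of everything on its left and `Z` is absorbed by a nonempty product
of at most `D` sets on its right. -/
def marks (α : FreeMonoid A →* M) (T : FreeMonoid A → Set (Fin (m + 2) → M)) (D : ℕ)
    (l : List (FreeMonoid A)) (p : M) : Set (Set (Fin (m + 2) → M) × M) :=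
  {x | ∃ l₁ l₃ l₄, l = l₁ ++ (l₃ ++ l₄) ∧ l₃ ≠ [] ∧ l₃.length ≤ D ∧
    x.1 * (l₃.map T).prod = (l₃.map T).prod ∧ p * α l₁.prod = x.2}

/-- Blocks of the same content, each of which is covered at the rank `k₀`, have a product that is
covered at a rank that does not depend on the number of blocks: the first cut with a repeated mark
is joined to the last cut with this mark by a single set `Z ^ ω (1, C) Z ^ ω`. The rest of the list
has fewer marks. -/
theorem exists_covers_list_prod [Finite M] (h𝒮 : IsSaturated α 𝒮) (hk₀ : 1 ≤ k₀)
    (hchains : ∀ k, k₀ ≤ k → chainsRank α (m + 1) k B ⊆ chains α (m + 1) B) {D : ℕ}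
    (hD : D = Nat.card (Set (Fin (m + 2) → M)) ^ 2) (c : ℕ) :
    ∀ (l : List (FreeMonoid A)) (p : M), (∀ y ∈ l, content y = B) → (∀ y ∈ l, T y ∈ 𝒮 B) →
      (∀ y ∈ l, chainSet α (m + 1) k₀ y ⊆ T y) → (marks α T D l p).ncard ≤ c →
      ∃ C ⊆ B, ∃ S ∈ 𝒮 C, Covers p (chainSet α (m + 1) (k₀ + D + 3 * c) l.prod) S := by
  induction c using Nat.strong_induction_on with
  | _ c ih =>
  intro l p hlB hlT hl hc
  by_cases hlen : l.length < D
  · refine ⟨if l = [] then ∅ else B, by split_ifs <;> simp, (l.map T).prod, ?_,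
      .of_subset (chainSet_prod_subset hk₀ hl (by omega))⟩
    split_ifs with hnil
    · subst hnil
      exact h𝒮.one_mem
    · exact h𝒮.list_prod_mem hlT hnil
  obtain ⟨l₁, z, l₃, l₄, hdec, hz, hsmall, hPZ, hZR⟩ :=
    exists_absorbed_factor T l (by omega)
  rw [← hD] at hsmall
  set Z := (z.map T).prod with hZ
  -- The last cut with the same mark: the one with the shortest list on its right.
  have hex : ∃ r, ∃ l₁' l₃' l₄', l = l₁' ++ (l₃' ++ l₄') ∧ l₃' ≠ [] ∧ l₃'.length ≤ D ∧
      Z * (l₃'.map T).prod = (l₃'.map T).prod ∧ p * α l₁'.prod = p * α l₁.prod ∧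
      (l₃' ++ l₄').length = r := by
    refine ⟨_, l₁, z ++ l₃, l₄, by rw [hdec, List.append_assoc], by simp [hz],
      by rw [List.length_append]; omega, ?_, rfl, rfl⟩
    rw [List.map_append, List.prod_append, hZR]
    exact hZR
  classical
  obtain ⟨l₁', l₃', l₄', hdec', hne', hlen', hZR', hval, hr⟩ := Nat.find_spec hex
  have hmin := fun r (hr : r < Nat.find hex) => Nat.find_min hex hr
  rw [← hr] at hmin
  obtain ⟨mid, hmid⟩ : ∃ mid, l₁' = l₁ ++ mid := by
    have hle : l₁.length ≤ l₁'.length := by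
      by_contra hlt
      refine hmin _ ?_ ⟨l₁, z ++ l₃, l₄, by rw [hdec, List.append_assoc], by simp [hz],
        by rw [List.length_append]; omega, by
          rw [List.map_append, List.prod_append, hZR]
          exact hZR, rfl, rfl⟩
      have e1 := congrArg List.length hdec
      have e2 := congrArg List.length hdec'
      simp only [List.length_append] at e1 e2 ⊢
      omega
    obtain ⟨mid, h⟩ := List.prefix_of_prefix_length_le (l₃ := l) ⟨_, hdec.symm⟩ ⟨_, hdec'.symm⟩ hle
    exact ⟨mid, h.symm⟩
  have hlt : (marks α T D l₄' (p * α (l₁' ++ l₃').prod)).ncard < (marks α T D l p).ncard := by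
    have hsub : marks α T D l₄' (p * α (l₁' ++ l₃').prod) ⊆ marks α T D l p := by
      rintro x ⟨a, b, d, rfl, h1, h2, h3, h4⟩
      refine ⟨l₁' ++ l₃' ++ a, b, d, by rw [hdec']; simp only [List.append_assoc], h1, h2, h3, ?_⟩
      rw [← h4, List.prod_append, map_mul, mul_assoc]
    refine Set.ncard_lt_ncard (Set.ssubset_iff_subset_ne.2 ⟨hsub, fun heq => ?_⟩) (Set.toFinite _)
    have hmem : (Z, p * α l₁.prod) ∈ marks α T D l p :=
      ⟨l₁', l₃', l₄', hdec', hne', hlen', hZR', hval⟩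
    rw [← heq] at hmem
    obtain ⟨a, b, d, hd, h1, h2, h3, h4⟩ := hmem
    refine hmin (b ++ d).length ?_ ⟨l₁' ++ l₃' ++ a, b, d, by
      rw [hdec', hd]; simp only [List.append_assoc], h1, h2, h3, ?_, rfl⟩
    · rw [hd]
      have := List.length_pos_iff.2 hne'
      simp only [List.length_append]
      omega
    · rw [List.prod_append, map_mul, ← mul_assoc, h4]
  obtain ⟨c, rfl⟩ : ∃ c', c = c' + 1 := ⟨c - 1, by omega⟩
  have mem₁ : ∀ y ∈ l₁, y ∈ l := fun y hy => by rw [hdec]; simp [hy]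
  have mem₂ : ∀ y ∈ mid, y ∈ l := fun y hy => by rw [hdec', hmid]; simp [hy]
  have mem₃ : ∀ y ∈ l₃', y ∈ l := fun y hy => by rw [hdec']; simp [hy]
  have mem₄ : ∀ y ∈ l₄', y ∈ l := fun y hy => by rw [hdec']; simp [hy]
  have memz : ∀ y ∈ z, y ∈ l := fun y hy => by rw [hdec]; simp [hy]
  obtain ⟨C, hCB, S, hS, hcov⟩ := ih c (Nat.lt_succ_self c) l₄' (p * α (l₁' ++ l₃').prod)
    (fun y hy => hlB y (mem₄ y hy)) (fun y hy => hlT y (mem₄ y hy))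
    (fun y hy => hl y (mem₄ y hy)) (by omega)
  set K := k₀ + D + 3 * c with hK
  have hprod : l.prod = l₁.prod * (mid.prod * (l₃'.prod * l₄'.prod)) := by
    rw [hdec', hmid]
    simp only [List.prod_append, mul_assoc]
  have hE : chainSet α (m + 1) (k₀ + D + 3 * (c + 1)) l.prod ⊆
      chainSet α (m + 1) K l₁.prod * chainSet α (m + 1) (K + 1) mid.prod *
        chainSet α (m + 1) K l₃'.prod * chainSet α (m + 1) K l₄'.prod := by
    rw [hprod, show k₀ + D + 3 * (c + 1) = K + 1 + 1 + 1 by omega, mul_assoc, mul_assoc]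
    exact (chainSet_mul_subset _ _).trans (Set.mul_subset_mul (chainSet_anti (by omega) _)
      ((chainSet_mul_subset _ _).trans (Set.mul_subset_mul_left (chainSet_mul_subset _ _))))
  have hE₁ : chainSet α (m + 1) K l₁.prod ⊆ (l₁.map T).prod :=
    chainSet_prod_subset hk₀ (fun y hy => hl y (mem₁ y hy)) (by omega)
  have hE₃ : chainSet α (m + 1) K l₃'.prod ⊆ (l₃'.map T).prod :=
    chainSet_prod_subset hk₀ (fun y hy => hl y (mem₃ y hy)) (by omega)
  have hfirst : ∀ s ∈ chainSet α (m + 1) K l₁.prod * chainSet α (m + 1) (K + 1) mid.prod *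
      chainSet α (m + 1) K l₃'.prod, s 0 = α (l₁' ++ l₃').prod := by
    rintro _ ⟨_, ⟨s, hs, t, ht, rfl⟩, r, hr, rfl⟩
    dsimp only
    rw [Pi.mul_apply, Pi.mul_apply, apply_zero_of_mem_chainSet hs, apply_zero_of_mem_chainSet ht,
      apply_zero_of_mem_chainSet hr, hmid]
    simp only [List.prod_append, map_mul]
  obtain ⟨C', hC', S', hS', hcov'⟩ : ∃ C' ⊆ B, ∃ S' ∈ 𝒮 C', Covers p
      (chainSet α (m + 1) K l₁.prod * chainSet α (m + 1) (K + 1) mid.prod *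
        chainSet α (m + 1) K l₃'.prod) S' := by
    by_cases hnil : mid = []
    · subst hnil
      refine ⟨B, le_rfl, ((l₁ ++ l₃').map T).prod, h𝒮.list_prod_mem
        (fun y hy => (List.mem_append.1 hy).elim (fun h => hlT y (mem₁ y h))
          fun h => hlT y (mem₃ y h)) (by simp [hne']), .of_subset ?_⟩
      rw [List.map_append, List.prod_append]
      refine Set.mul_subset_mul ?_ hE₃
      rw [← mul_one ((l₁.map T).prod)]
      exact Set.mul_subset_mul hE₁ chainSet_one_subset
    · have hF := h𝒮.omega_mem (h𝒮.list_prod_mem (fun y hy => hlT y (memz y hy)) hz)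
      have hR := h𝒮.mul_mem hF (h𝒮.list_prod_mem (fun y hy => hlT y (mem₃ y hy)) hne')
      rw [Set.union_self] at hR
      have hcontent := content_list_prod (fun y hy => hlB y (mem₂ y hy)) hnil
      refine ⟨B, le_rfl, _, ?_, covers_omega (α := α) (B := B)
        (omegaExp (Set (Fin (m + 2) → M))) hPZ hZR' hE₁ hE₃
        (fun s hs => apply_zero_of_mem_chainSet hs)
        (fun s hs => apply_zero_of_mem_chainSet hs) ?_ fun s hs => ?_⟩
      · rw [mul_assoc]
        by_cases hnil₁ : l₁ = []
        · simpa [hnil₁] using hR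
        · have := h𝒮.mul_mem (h𝒮.list_prod_mem (fun y hy => hlT y (mem₁ y hy)) hnil₁) hR
          rwa [Set.union_self] at this
      · rwa [hmid, List.prod_append, map_mul, ← mul_assoc] at hval
      · have := tail_mem_chainsRank hs
        rw [hcontent] at this
        exact hchains _ (by omega) this
  exact ⟨C' ∪ C, Set.union_subset hC' hCB, S' * S, h𝒮.mul_mem hS' hS,
    (hcov'.mul hfirst hcov).mono hE⟩

end Sequences

/-- Every word is cut into blocks that are minimal with content `B`, and a rest. -/
theorem exists_blocks {B : Set A} (hB : B.Nonempty) (w : FreeMonoid A) (hw : content w ⊆ B) :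
    ∃ (l : List (FreeMonoid A)) (z : FreeMonoid A), w = l.prod * z ∧ content z ⊂ B ∧
      ∀ y ∈ l, content y = B ∧ ∃ x a, y = x * FreeMonoid.of a ∧ content x ⊂ B := by
  have hB' : content (1 : FreeMonoid A) ⊂ B := by
    rw [content_one]
    exact Set.empty_ssubset.2 hB
  suffices h : ∀ t : List A, content (FreeMonoid.ofList t) ⊆ B →
      ∃ (l : List (FreeMonoid A)) (z : FreeMonoid A), FreeMonoid.ofList t = l.prod * z ∧
        content z ⊂ B ∧ ∀ y ∈ l, content y = B ∧ ∃ x a, y = x * FreeMonoid.of a ∧ content x ⊂ B from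
    h w.toList hw
  intro l
  induction l using List.reverseRecOn with
  | nil => exact fun _ => ⟨[], 1, by simp, hB', by simp⟩
  | append_singleton t a ih =>
    intro h
    have e : FreeMonoid.ofList (t ++ [a]) = FreeMonoid.ofList t * FreeMonoid.of a := rfl
    rw [e, content_mul, Set.union_subset_iff] at h
    obtain ⟨l, z, hz, hzB, hl⟩ := ih h.1
    by_cases hc : content (z * FreeMonoid.of a) = B
    · refine ⟨l ++ [z * FreeMonoid.of a], 1, ?_, hB', ?_⟩
      · rw [e, hz]
        simp [mul_assoc]
      · intro y hy
        rcases List.mem_append.1 hy with hy | hy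
        · exact hl y hy
        · obtain rfl := List.mem_singleton.1 hy
          exact ⟨hc, z, a, rfl, hzB⟩
    · refine ⟨l, z * FreeMonoid.of a, by rw [e, hz, mul_assoc], ?_, hl⟩
      refine Set.ssubset_iff_subset_ne.2 ⟨?_, hc⟩
      rw [content_mul]
      exact Set.union_subset hzB.subset h.2

/-- The set of chains that start with `w` is covered, at a rank that depends only on the size of
the content of `w`. -/
theorem exists_chainSet_subset [Finite A] [Finite M]
    {𝒮 : Set A → Set (Set (Fin (m + 2) → M))} (h𝒮 : IsSaturated α 𝒮) {b : ℕ} (hb : 2 ≤ b)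
    (hchains : ∀ k, b ≤ k → ∀ B, chainsRank α (m + 1) k B ⊆ chains α (m + 1) B) {Q c : ℕ}
    (hQ : Q = Nat.card (Set (Fin (m + 2) → M))) (hc : c = Q ^ 2 + 3 * (Q * Nat.card M) + 3)
    (j : ℕ) : ∀ w, (content w).ncard ≤ j →
      ∃ S ∈ 𝒮 (content w), chainSet α (m + 1) (b + j * c) w ⊆ S := by
  have hempty : ∀ (k : ℕ) (w : FreeMonoid A), 1 ≤ k → content w = ∅ →
      ∃ S ∈ 𝒮 (content w), chainSet α (m + 1) k w ⊆ S := by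
    intro k w hk hw
    obtain ⟨k, rfl⟩ : ∃ k', k = k' + 1 := ⟨k - 1, by omega⟩
    rw [hw, content_eq_empty_iff.1 hw]
    exact ⟨1, h𝒮.one_mem, chainSet_one_subset⟩
  induction j with
  | zero =>
    intro w hw
    exact hempty _ w (by omega) ((Set.ncard_eq_zero (Set.toFinite _)).1 (by omega))
  | succ j ih =>
    intro w hw
    rcases Set.eq_empty_or_nonempty (content w) with hB | hB
    · exact hempty _ w (by omega) hB
    obtain ⟨l, z, hwl, hz, hl⟩ := exists_blocks hB w le_rfl
    have hless : ∀ x : FreeMonoid A, content x ⊂ content w →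
        ∃ S ∈ 𝒮 (content x), chainSet α (m + 1) (b + j * c) x ⊆ S := fun x hx =>
      ih x (by have := Set.ncard_lt_ncard hx (Set.toFinite _); omega)
    have hblock : ∀ y, y ∈ l → ∃ T ∈ 𝒮 (content w), chainSet α (m + 1) (b + j * c + 1) y ⊆ T := by
      intro y hy
      obtain ⟨hyB, x, a, rfl, hx⟩ := hl y hy
      obtain ⟨S, hS, hxS⟩ := hless x hx
      have hmem := h𝒮.mul_mem hS (h𝒮.const_mem (FreeMonoid.of a))
      rw [← content_mul, hyB] at hmem
      refine ⟨_, hmem, (chainSet_mul_subset _ _).trans (Set.mul_subset_mul hxS ?_)⟩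
      exact (chainSet_anti (show (b - 2) + 2 ≤ _ by omega) _).trans (chainSet_of_subset a)
    choose! T hT hyT using hblock
    cases l with
    | nil =>
      rw [List.prod_nil, one_mul] at hwl
      exact (hz.ne (by rw [hwl])).elim
    | cons y l =>
    have mem : ∀ x ∈ l, x ∈ y :: l := fun x hx => List.mem_cons_of_mem _ hx
    set k₁ := b + j * c + 1 + Q ^ 2 + 3 * (Q * Nat.card M) with hk₁
    have hmarks : (marks α T (Q ^ 2) l 1).ncard ≤ Q * Nat.card M := by
      rw [hQ, ← Nat.card_prod]
      exact Set.ncard_le_card _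
    obtain ⟨C, hC, S, hS, hcov⟩ := exists_covers_list_prod h𝒮 (k₀ := b + j * c + 1) (by omega)
      (fun k hk => hchains k (by omega) (content w)) (by rw [hQ]) _ l 1
      (fun x hx => (hl x (mem x hx)).1) (fun x hx => hT x (mem x hx))
      (fun x hx => hyT x (mem x hx)) hmarks
    rw [← hk₁] at hcov
    obtain ⟨R, hR, hzR⟩ := hless z hz
    refine ⟨T y * (S * R), ?_, ?_⟩
    · have := h𝒮.mul_mem (hT y List.mem_cons_self) (h𝒮.mul_mem hS hR)
      rwa [Set.union_eq_left.2 (Set.union_subset hC hz.subset)] at this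
    · nth_rw 1 [hwl]
      rw [List.prod_cons, mul_assoc,
        show b + (j + 1) * c = k₁ + 1 + 1 by rw [hk₁, hc]; ring]
      refine (chainSet_mul_subset _ _).trans (Set.mul_subset_mul
        ((chainSet_anti (by omega) _).trans (hyT y List.mem_cons_self))
        ((chainSet_mul_subset _ _).trans (Set.mul_subset_mul hcov.subset
          ((chainSet_anti (by omega) _).trans hzR))))

end Completeness

/-! ### The characterization -/

/-- Completeness at the rank `ℓ` suffices, since the other inclusions hold at every rank. -/
theorem compat_eq_of_compatRank_subset {A M : Type*} [Finite A] [Monoid M] [Finite M]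
    {α : FreeMonoid A →* M} {n ℓ : ℕ} {B : Set A}
    (h : compatRank α (n + 1) ℓ B ⊆
      downset (satStar α (n + 1) (fun C => trivialSets α (n + 1) C) B)) :
    compat α (n + 1) B = compatRank α (n + 1) ℓ B ∧ compatRank α (n + 1) ℓ B =
      downset (satStar α (n + 1) (fun C => trivialSets α (n + 1) C) B) := by
  have h₁ : compat α (n + 1) B ⊆ compatRank α (n + 1) ℓ B := fun T hT => hT ℓ
  have h₂ : downset (satStar α (n + 1) (fun C => trivialSets α (n + 1) C) B) ⊆
      compat α (n + 1) B := fun T ⟨S, hS, hTS⟩ =>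
    compat_subset_compat_of_subset hTS (satStar_subset_compat B hS)
  exact ⟨h₁.antisymm (h.trans h₂), h.antisymm (h₂.trans h₁)⟩

/-- The arithmetic behind the rank, for chains of length `n + 1`: `s` is the size of the monoid, `a`
that of the alphabet, `Q` the number of sets of tuples. The first two summands on the left are the
rank that is needed for chains of length `n`, with its own exponent `q'`, and a constant; the last
one is the cost of `a` levels of contents. -/
theorem rank_bound {s a n Q q' ℓ : ℕ} (hs : 1 ≤ s) (hQ : 2 ≤ Q) (hq : q' ≤ Q ^ 2)
    (hℓ : 3 * s * 2 ^ a * (n + 1) * 2 ^ (Q ^ 2) ≤ ℓ) :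
    3 * s * 2 ^ a * n * 2 ^ q' + 2 + a * (Q ^ 2 + 3 * (Q * s) + 3) ≤ ℓ := by
  have h1 : 3 * s * 2 ^ a * n * 2 ^ q' ≤ 3 * s * 2 ^ a * n * 2 ^ (Q ^ 2) :=
    Nat.mul_le_mul_left _ (Nat.pow_le_pow_right (by norm_num) hq)
  have ha : a + 1 ≤ 2 ^ a := Nat.lt_two_pow_self
  have h2 : 4 * Q ^ 2 ≤ 2 ^ (Q ^ 2) := by
    have : ∀ t, 4 ≤ t → 4 * t ≤ 2 ^ t := by
      intro t ht
      induction t, ht using Nat.le_induction with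
      | base => norm_num
      | succ t _ ih => rw [pow_succ]; omega
    exact this _ (by nlinarith)
  have h3 : Q ^ 2 + 3 * (Q * s) + 3 ≤ 3 * s * 2 ^ (Q ^ 2) := by
    have h4 : Q ≤ Q ^ 2 := Nat.le_self_pow (by norm_num) Q
    have h5 : 1 ≤ Q ^ 2 := by omega
    calc Q ^ 2 + 3 * (Q * s) + 3 ≤ s * Q ^ 2 + 3 * (Q ^ 2 * s) + s * (3 * Q ^ 2) := by
          gcongr
          · exact Nat.le_mul_of_pos_left _ hs
          · nlinarith
      _ ≤ 3 * s * (4 * Q ^ 2) := by nlinarith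
      _ ≤ 3 * s * 2 ^ (Q ^ 2) := Nat.mul_le_mul_left _ h2
  have h6 : 2 ≤ 3 * s * 2 ^ (Q ^ 2) := by omega
  refine le_trans ?_ hℓ
  calc 3 * s * 2 ^ a * n * 2 ^ q' + 2 + a * (Q ^ 2 + 3 * (Q * s) + 3)
      ≤ 3 * s * 2 ^ a * n * 2 ^ (Q ^ 2) + 3 * s * 2 ^ (Q ^ 2) + a * (3 * s * 2 ^ (Q ^ 2)) := by
        gcongr
    _ = 3 * s * 2 ^ a * n * 2 ^ (Q ^ 2) + (a + 1) * (3 * s * 2 ^ (Q ^ 2)) := by ring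
    _ ≤ 3 * s * 2 ^ a * n * 2 ^ (Q ^ 2) + 2 ^ a * (3 * s * 2 ^ (Q ^ 2)) := by gcongr
    _ = 3 * s * 2 ^ a * (n + 1) * 2 ^ (Q ^ 2) := by ring

theorem proposition1 {A M : Type*} [Finite A] [Monoid M] [Finite M] (α : FreeMonoid A →* M)
    (n : ℕ) (hn : 1 ≤ n) (B : Set A) (ℓ : ℕ)
    (hℓ : 3 * Nat.card M * 2 ^ Nat.card A * n * 2 ^ (2 ^ (2 * Nat.card M ^ n)) ≤ ℓ) :
    compat α n B = compatRank α n ℓ B ∧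
      compatRank α n ℓ B = downset (satStar α n (fun C => trivialSets α n C) B) := by
  obtain ⟨n, rfl⟩ : ∃ n', n = n' + 1 := ⟨n - 1, by omega⟩
  clear hn
  induction n generalizing B ℓ with
  | zero =>
    refine compat_eq_of_compatRank_subset ?_
    rintro T ⟨w, rfl, h⟩
    refine ⟨_, (mem_satStar_iff _ _ _ _ _).2 ⟨0, w, rfl, rfl⟩, fun s hs => ?_⟩
    obtain ⟨u, hu, -, hs, -⟩ := h s hs
    funext j
    rw [← hs j, hu j (by omega)]
  | succ m ih =>
    refine compat_eq_of_compatRank_subset ?_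
    set b := 3 * Nat.card M * 2 ^ Nat.card A * (m + 1) * 2 ^ (2 ^ (2 * Nat.card M ^ (m + 1))) + 2
      with hb
    have hchains : ∀ k, b ≤ k → ∀ B, chainsRank α (m + 1) k B ⊆ chains α (m + 1) B := by
      intro k hk B s hs j
      rw [mem_chainsRank_iff, ← (ih B k (by omega)).1] at hs
      exact mem_chainsRank_iff.2 (hs j)
    have hQ : Nat.card (Set (Fin (m + 2) → M)) = 2 ^ Nat.card M ^ (m + 2) := by
      have := Fintype.ofFinite (Fin (m + 2) → M)
      rw [Nat.card_eq_fintype_card, Fintype.card_set, ← Nat.card_eq_fintype_card, Nat.card_fun,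
        Nat.card_eq_fintype_card (α := Fin _), Fintype.card_fin]
    have hM : 1 ≤ Nat.card M := Nat.card_pos
    have hQ2 : 2 ≤ Nat.card (Set (Fin (m + 2) → M)) := by
      rw [hQ]
      exact Nat.le_self_pow (pow_pos hM _).ne' 2
    have hbound := rank_bound (a := Nat.card A) (n := m + 1)
      (q' := 2 ^ (2 * Nat.card M ^ (m + 1))) (ℓ := ℓ) hM hQ2 (by
        rw [hQ, ← pow_mul, mul_comm]
        gcongr <;> omega) (by
        rw [hQ, ← pow_mul, mul_comm _ 2]
        exact hℓ)
    rw [← hb] at hbound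
    intro T hT
    obtain ⟨ℓ, rfl⟩ : ∃ ℓ', ℓ = ℓ' + 1 := ⟨ℓ - 1, by omega⟩
    obtain ⟨w, rfl, hw⟩ := mem_compatRank_iff.1 hT
    obtain ⟨S, hS, hwS⟩ := exists_chainSet_subset (isSaturated_satStar α m) (by omega) hchains rfl
      rfl (Nat.card A) w (Set.ncard_le_card _)
    exact ⟨S, hS, hw.trans ((chainSet_anti hbound w).trans hwS)⟩
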